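/- Consider a contextual $K$-armed bandit with $K\ge 1$ arms, horizon $n\ge1$ and a sequence of contexts $x_1,\dots,x_n\in\mathbb{R}^d$ ($d\ge1$) that is fixed in advance. In round $t$ the agent pulls an arm $I_t\in[K]$ and observes the reward $Y_{I_t,t}$ of that arm. The reward $Y_{i,t}$ of arm $i$ in round $t$ has mean $x_t^\top\theta_{i}$ for some fixed unknown $\theta_{i}\in\mathbb{R}^d$, and $Y_{i,t}-x_t^\top\theta_i$ is $\sigma^2$-sub-Gaussian, $\sigma>0$; the rewards $(Y_{i,t})_{i\in[K]}$ of round $t$ are independent of $I_t$ and of the history $H_t$, that is, of the arms pulled and the rewards observed in the rounds before $t$. The policy CoSoftElim with projection matrix $W=I_d$, regularization $\lambda>0$ and score parameter $\gamma$ pulls arm $i$ in round $t$, conditionally on $H_t$, with probability $$\pi_{i,t}=\frac{\exp[-S_{i,t}]}{\sum_{j=1}^K\exp[-S_{j,t}]},\qquad S_{i,t}=\frac{\gamma\,(\max_j\hat\mu_{j,t}-\hat\mu_{i,t})^2}{x_t^\top G_{i,t-1}^{-1}x_t},\qquad \hat\mu_{i,t}=x_t^\top\hat\theta_{i,t-1},$$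 where $G_{i,t}=\lambda I_d+\sum_{\ell\le t}\mathbf 1\{I_\ell=i\}x_\ell x_\ell^\top$ and $\hat\theta_{i,t}=G_{i,t}^{-1}\sum_{\ell\le t}\mathbf 1\{I_\ell=i\}Y_{i,\ell}\,x_\ell$ (if $x_t=0$, all scores $S_{i,t}$ are $0$). Let $L=\max_{t\le n}\|x_t\|_2$, $L_*=(\sum_{i}\|\theta_i\|_2^2)^{1/2}$, $\Delta_{\max}=\max_{t\le n,\,i\in[K]}\bigl(\max_j x_t^\top\theta_j-x_t^\top\theta_i\bigr)$, and $$c_1=\sigma\sqrt{Kd\log\Bigl(n\Bigl(1+\frac{nL^2}{Kd\lambda}\Bigr)\Bigr)}+\sqrt{\lambda}\,L_*,\qquad c_2=2Kd\log\Bigl(1+\frac{nL^2}{Kd\lambda}\Bigr).$$ Let $\lambda\ge L^2$ and $\gamma=c_1^{-2}$ (with the convention $\gamma=0$ in the degenerate case $c_1=0$). Then, for any choice of optimal arms $i_{*,t}\in\arg\max_i x_t^\top\theta_i$, the $n$-round regret $\sum_{t=1}^n(Y_{i_{*,t},t}-Y_{I_t,t})$ is integrable and its expectation $R(n)=\mathbb{E}\bigl[\sum_{t=1}^n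 (Y_{i_{*,t},t}-Y_{I_t,t})\bigr]$ satisfies $$R(n)\le(12Ke+3)\,c_1\sqrt{c_2\,n\log n}+(K+1)\Delta_{\max}.$$ Moreover $c_1=\tilde O(\sqrt{Kd})$, $c_2=\tilde O(Kd)$ and $R(n)=\tilde O(K^2d\sqrt n)$: there is a universal constant $C>0$ such that always $$c_1\le C(\sigma+\sqrt\lambda L_*)\sqrt{Kd\,\log(n+1)},\quad c_2\le C\,Kd\,\log(n+1),\quad R(n)\le C(\sigma+\sqrt\lambda L_*)\,K^2d\sqrt n\,\log^{3/2}(n+1).$$ -/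

import Mathlib

open MeasureTheory ProbabilityTheory
open scoped Matrix NNReal

namespace Bandit

/-! ### Stochastic contextual bandits

Rounds are numbered `0, 1, …, n - 1`, and arms are the elements of `Fin K`. -/

/-- What the agent has observed before round `t` (apart from the contexts, which are fixed in
advance): the pulled arm and its reward, for each of the rounds `0, …, t - 1`. -/
abbrev History (K t : ℕ) : Type := Fin t → Fin K × ℝ

/-- A randomized policy: `π t h i` is the probability of pulling arm `i` in round `t` when the
history is `h`. -/
abbrev Policy (K : ℕ) : Type := (t : ℕ) → History K t → Fin K → ℝ

/-- The random history at the beginning of round `t`, where `I s` is the arm pulled in round `s`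
and `Y s i` is the realized reward of arm `i` in round `s`. -/
def history {Ω : Type*} {K : ℕ} (I : ℕ → Ω → Fin K) (Y : ℕ → Ω → Fin K → ℝ) (t : ℕ) (ω : Ω) :
    History K t :=
  fun s => (I s ω, Y s ω (I s ω))

/-- `I` and `Y` are the pulled arms and the realized rewards of an `n`-round interaction of the
policy `π` with a bandit whose mean rewards are `f t i` and whose reward noise is
`σ²`-sub-Gaussian. The rewards of different arms in the same round may be dependent. -/
structure IsInteraction {Ω : Type*} [MeasurableSpace Ω] (P : Measure Ω) {K : ℕ} (n : ℕ)
    (f : ℕ → Fin K → ℝ) (σ : ℝ≥0) (π : Policy K)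
    (I : ℕ → Ω → Fin K) (Y : ℕ → Ω → Fin K → ℝ) : Prop where
  measurable_arm : ∀ t < n, Measurable (I t)
  measurable_reward : ∀ t < n, Measurable (Y t)
  /-- The reward of arm `i` in round `t` has mean `f t i`. -/
  mean_reward : ∀ t < n, ∀ i, ∫ ω, Y t ω i ∂P = f t i
  /-- The centred rewards are `σ²`-sub-Gaussian. -/
  subgaussian_reward : ∀ t < n, ∀ i, HasSubgaussianMGF (fun ω => Y t ω i - f t i) (σ ^ 2) P
  /-- The rewards of round `t` are drawn independently of the observed history and of the arm
  that the agent pulls in round `t`. -/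
  indep_reward : ∀ t < n, IndepFun (fun ω => (history I Y t ω, I t ω)) (Y t) P
  /-- Given the history, arm `i` is pulled in round `t` with probability `π t (history) i`. -/
  arm_law : ∀ t < n, ∀ i,
    P[(I t ⁻¹' {i}).indicator (fun _ => (1 : ℝ)) |
        MeasurableSpace.comap (history I Y t) inferInstance]
      =ᵐ[P] fun ω => π t (history I Y t ω) i

/-- The realized `n`-round regret with respect to the arms `istar t`. -/
def realizedRegret {Ω : Type*} {K : ℕ} (n : ℕ) (istar : ℕ → Fin K)
    (I : ℕ → Ω → Fin K) (Y : ℕ → Ω → Fin K → ℝ) (ω : Ω) : ℝ :=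
  ∑ t ∈ Finset.range n, (Y t ω (istar t) - Y t ω (I t ω))

/-- The expected `n`-round regret. -/
noncomputable def regret {Ω : Type*} [MeasurableSpace Ω] (P : Measure Ω) {K : ℕ} (n : ℕ)
    (istar : ℕ → Fin K) (I : ℕ → Ω → Fin K) (Y : ℕ → Ω → Fin K → ℝ) : ℝ :=
  ∫ ω, realizedRegret n istar I Y ω ∂P

/-! ### The linear model -/

/-- The mean reward of arm `i` in round `t`, `x_tᵀ θ_i`. -/
noncomputable def linMean {d K : ℕ} (x : ℕ → EuclideanSpace ℝ (Fin d))
    (θ : Fin K → EuclideanSpace ℝ (Fin d)) (t : ℕ) (i : Fin K) : ℝ :=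
  inner ℝ (x t) (θ i)

/-- The gap of arm `i` in round `t`. -/
noncomputable def gap {d K : ℕ} (x : ℕ → EuclideanSpace ℝ (Fin d))
    (θ : Fin K → EuclideanSpace ℝ (Fin d)) (t : ℕ) (i : Fin K) : ℝ :=
  (⨆ j, linMean x θ t j) - linMean x θ t i

/-- `Δ_max`, the maximum gap over all arms and the first `n` rounds. -/
noncomputable def maxGap {d K : ℕ} (n : ℕ) (x : ℕ → EuclideanSpace ℝ (Fin d))
    (θ : Fin K → EuclideanSpace ℝ (Fin d)) : ℝ :=
  ⨆ p : Fin n × Fin K, gap x θ p.1 p.2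

/-- `L`, the maximum Euclidean length of the first `n` contexts. -/
noncomputable def maxLength {d : ℕ} (n : ℕ) (x : ℕ → EuclideanSpace ℝ (Fin d)) : ℝ :=
  ⨆ t : Fin n, ‖x t‖

/-- `L_*`, the Euclidean length of the concatenation of the vectors `θ_i`. -/
noncomputable def paramLength {d K : ℕ} (θ : Fin K → EuclideanSpace ℝ (Fin d)) : ℝ :=
  √(∑ i, ‖θ i‖ ^ 2)

/-! ### The policy CoSoftElim -/

/-- `‖v‖_M = √(vᵀ M v)`. -/
noncomputable def wnorm {d : ℕ} (M : Matrix (Fin d) (Fin d) ℝ) (v : Fin d → ℝ) : ℝ :=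
  √(v ⬝ᵥ M *ᵥ v)

/-- The projected context `W x_t`. -/
noncomputable def proj {d : ℕ} (W : Matrix (Fin d) (Fin d) ℝ)
    (x : ℕ → EuclideanSpace ℝ (Fin d)) (t : ℕ) : Fin d → ℝ :=
  W *ᵥ (x t).ofLp

/-- The regularized sample covariance matrix of arm `i` given the history of the rounds
before `t`. -/
noncomputable def gram {d K : ℕ} (W : Matrix (Fin d) (Fin d) ℝ)
    (x : ℕ → EuclideanSpace ℝ (Fin d)) (lam : ℝ) (t : ℕ) (h : History K t) (i : Fin K) :
    Matrix (Fin d) (Fin d) ℝ :=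
  ∑ s : Fin t, (if (h s).1 = i then Matrix.vecMulVec (proj W x s) (proj W x s) else 0)
    + lam • (1 : Matrix (Fin d) (Fin d) ℝ)

/-- The (regularized) maximum likelihood estimate of the parameter of arm `i` given the history
of the rounds before `t`. -/
noncomputable def estimate {d K : ℕ} (W : Matrix (Fin d) (Fin d) ℝ)
    (x : ℕ → EuclideanSpace ℝ (Fin d)) (lam : ℝ) (t : ℕ) (h : History K t) (i : Fin K) :
    Fin d → ℝ :=
  (gram W x lam t h i)⁻¹ *ᵥ ∑ s : Fin t, (if (h s).1 = i then (h s).2 • proj W x s else 0)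

/-- The estimated reward of arm `i` in round `t`. -/
noncomputable def estMean {d K : ℕ} (W : Matrix (Fin d) (Fin d) ℝ)
    (x : ℕ → EuclideanSpace ℝ (Fin d)) (lam : ℝ) (t : ℕ) (h : History K t) (i : Fin K) : ℝ :=
  proj W x t ⬝ᵥ estimate W x lam t h i

/-- The score of arm `i` in round `t` (it is `0` for every arm if `W x_t = 0`). -/
noncomputable def score {d K : ℕ} (W : Matrix (Fin d) (Fin d) ℝ)
    (x : ℕ → EuclideanSpace ℝ (Fin d)) (lam γ : ℝ) (t : ℕ) (h : History K t) (i : Fin K) : ℝ :=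
  γ * ((⨆ j, estMean W x lam t h j) - estMean W x lam t h i) ^ 2
    / wnorm (gram W x lam t h i)⁻¹ (proj W x t) ^ 2

/-- CoSoftElim with projection matrix `W`, regularization `lam` and score parameter `γ`: the
softmax of the negated scores. -/
noncomputable def coSoftElim {d K : ℕ} (W : Matrix (Fin d) (Fin d) ℝ)
    (x : ℕ → EuclideanSpace ℝ (Fin d)) (lam γ : ℝ) : Policy K :=
  fun t h i => Real.exp (-score W x lam γ t h i) / ∑ j, Real.exp (-score W x lam γ t h j)

/-! ### The constants of the regret bound -/

/-- The confidence width `c₁` at level `δ`. -/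
noncomputable def c₁ (K d n : ℕ) (σ lam L Lstar δ : ℝ) : ℝ :=
  σ * √(K * d * Real.log ((1 + n * L ^ 2 / (K * d * lam)) / δ)) + √lam * Lstar

/-- The bound `c₂` on the sum of squared confidence widths. -/
noncomputable def c₂ (K d n : ℕ) (lam L : ℝ) : ℝ :=
  2 * K * d * Real.log (1 + n * L ^ 2 / (K * d * lam))

end Bandit

namespace Bandit

/-! ### Rank-one updates and positive definite matrices -/

section LinearAlgebra

variable {ι : Type*}

/-! Since the rewards of a round are independent of the history and of the pulled arm, the regret is
a sum of expected gaps of the pulled arms (`IsInteraction.regret_eq`). Each round is bounded on its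
own, by a concentration bound, a property of the softmax and a potential argument.

Concentration. For each arm the error of the ridge estimate at `x_t` is at most the width `√(x_tᵀ
G⁻¹ x_t)` times the self-normalized noise plus `√λ L_*`. The squared self-normalized noises of all
arms are added up in `noiseEnergy`. The variable `exp((noiseEnergy / σ² - infoGain) / 2)` has mean
at most 1 by the method of mixtures: each round multiplies it by a factor that is an average of
`exp(u η - u² / 2)`, with `η` the scaled noise, over a Gaussian `u` (`lintegral_exp_quadratic_le`).
Markov's inequality at the fixed round `t` shows that the confidence intervals of all arms, with
constant `c₁`, hold outside an event of probability `1 / n`. These events cost one `Δ_max` over the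
`n` rounds.

Softmax (`sum_softmax_mul_gap_le`). An arm whose score is at least `log n` has probability at most
`1 / n`; such arms cost at most `K Δ_max` in total. The gap of any other arm is at most a multiple
of its own width, plus the width of the optimal arm when the latter has score at most 1. In that
case the optimal arm has probability at least `1 / (K e)`, so its width is at most `K e` times the
mean width under the policy. If its score exceeds 1, the largest estimate already dominates the
optimal mean and no extra term is needed.

Potential. The mean width under the policy is the expected width of the pulled arm. Squared widths
of pulled arms sum to at most `2 * infoGain ≤ c₂` (`sum_sqWidth_le`, `infoGain_le`), and
Cauchy–Schwarz gives `√(c₂ n)`. -/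

theorem isSymm_of_posDef {A : Matrix ι ι ℝ} (hA : A.PosDef) : A.IsSymm := by
  have := hA.isHermitian
  rwa [Matrix.IsHermitian, Matrix.conjTranspose_eq_transpose_of_trivial] at this

variable [Fintype ι]

theorem dotProduct_mulVec_comm_of_isSymm {A : Matrix ι ι ℝ} (hA : A.IsSymm) (u v : ι → ℝ) :
    u ⬝ᵥ A *ᵥ v = v ⬝ᵥ A *ᵥ u := by
  rw [Matrix.dotProduct_mulVec, ← Matrix.mulVec_transpose, hA.eq, dotProduct_comm]

theorem dotProduct_mulVec_self_nonneg {A : Matrix ι ι ℝ} (hA : A.PosDef) (u : ι → ℝ) :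
    0 ≤ u ⬝ᵥ A *ᵥ u := by
  simpa using hA.posSemidef.dotProduct_mulVec_nonneg u

theorem dotProduct_mulVec_sq_le {A : Matrix ι ι ℝ} (hA : A.PosDef) (u v : ι → ℝ) :
    (u ⬝ᵥ A *ᵥ v) ^ 2 ≤ (u ⬝ᵥ A *ᵥ u) * (v ⬝ᵥ A *ᵥ v) := by
  by_cases hv : v = 0
  · simp [hv]
  have hpos : 0 < v ⬝ᵥ A *ᵥ v := by simpa using hA.dotProduct_mulVec_pos hv
  have hcomm := dotProduct_mulVec_comm_of_isSymm (isSymm_of_posDef hA) v u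
  -- Cauchy–Schwarz: the form is nonnegative at a multiple of the component of `u` that is
  -- `A`-orthogonal to `v`.
  have h := dotProduct_mulVec_self_nonneg hA ((v ⬝ᵥ A *ᵥ v) • u - (u ⬝ᵥ A *ᵥ v) • v)
  simp only [Matrix.mulVec_sub, Matrix.mulVec_smul, sub_dotProduct, dotProduct_sub,
    smul_dotProduct, dotProduct_smul, smul_eq_mul, hcomm] at h
  have h2 : 0 ≤ (v ⬝ᵥ A *ᵥ v) * ((u ⬝ᵥ A *ᵥ u) * (v ⬝ᵥ A *ᵥ v) - (u ⬝ᵥ A *ᵥ v) ^ 2) := by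
    nlinarith
  have := nonneg_of_mul_nonneg_right h2 hpos
  linarith

variable [DecidableEq ι]

theorem det_add_vecMulVec_self {V : Matrix ι ι ℝ} (hV : V.PosDef) (x : ι → ℝ) :
    (V + Matrix.vecMulVec x x).det = V.det * (1 + x ⬝ᵥ V⁻¹ *ᵥ x) := by
  rw [Matrix.vecMulVec_eq Unit, Matrix.det_add_replicateCol_mul_replicateRow
    hV.det_pos.ne'.isUnit, Matrix.dotProduct_mulVec]
  congr 2
  simp [Matrix.replicateRow, Matrix.replicateCol, Matrix.mul_apply, Matrix.vecMul, dotProduct]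

/-- The Sherman–Morrison formula. -/
theorem inv_add_vecMulVec_self {V : Matrix ι ι ℝ} (hV : V.PosDef) (x : ι → ℝ) :
    (V + Matrix.vecMulVec x x)⁻¹ =
      V⁻¹ - (1 + x ⬝ᵥ V⁻¹ *ᵥ x)⁻¹ • Matrix.vecMulVec (V⁻¹ *ᵥ x) (V⁻¹ *ᵥ x) := by
  have hu : IsUnit V.det := hV.det_pos.ne'.isUnit
  have hw : 1 + x ⬝ᵥ V⁻¹ *ᵥ x ≠ 0 := by
    have := dotProduct_mulVec_self_nonneg hV.inv x
    positivity
  have hs : x ᵥ* V⁻¹ = V⁻¹ *ᵥ x := by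
    rw [← Matrix.mulVec_transpose, (isSymm_of_posDef hV.inv).eq]
  apply Matrix.inv_eq_right_inv
  rw [Matrix.mul_sub, Matrix.add_mul, Matrix.mul_nonsing_inv _ hu, Matrix.vecMulVec_mul, hs,
    Matrix.mul_smul, Matrix.add_mul, Matrix.mul_vecMulVec, Matrix.mulVec_mulVec,
    Matrix.mul_nonsing_inv _ hu, Matrix.one_mulVec, Matrix.vecMulVec_mul_vecMulVec]
  set b := V⁻¹ *ᵥ x
  rw [Matrix.vecMulVec_smul, add_sub_assoc, add_eq_left]
  ext i j
  simp only [Matrix.sub_apply, Matrix.add_apply, Matrix.smul_apply, smul_eq_mul, Matrix.zero_apply]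
  field_simp
  ring

/-- Sherman–Morrison, expanded. Half of the increment is the exponent in
`lintegral_exp_quadratic_le`, with `m = xᵀV⁻¹S` and `w = xᵀV⁻¹x`. -/
theorem quadForm_rank_one_update {V : Matrix ι ι ℝ} (hV : V.PosDef) (x S : ι → ℝ) (η : ℝ) :
    (S + η • x) ⬝ᵥ (V + Matrix.vecMulVec x x)⁻¹ *ᵥ (S + η • x) =
      S ⬝ᵥ V⁻¹ *ᵥ S + (2 * η * (x ⬝ᵥ V⁻¹ *ᵥ S) + η ^ 2 * (x ⬝ᵥ V⁻¹ *ᵥ x)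
        - (x ⬝ᵥ V⁻¹ *ᵥ S) ^ 2) / (1 + x ⬝ᵥ V⁻¹ *ᵥ x) := by
  have hw : 0 < 1 + x ⬝ᵥ V⁻¹ *ᵥ x := by
    have := dotProduct_mulVec_self_nonneg hV.inv x
    positivity
  have hc := dotProduct_mulVec_comm_of_isSymm (isSymm_of_posDef hV.inv) S x
  have h1 : (V⁻¹ *ᵥ x) ⬝ᵥ S = x ⬝ᵥ V⁻¹ *ᵥ S := by rw [dotProduct_comm, hc]
  have h2 : (V⁻¹ *ᵥ x) ⬝ᵥ x = x ⬝ᵥ V⁻¹ *ᵥ x := dotProduct_comm _ _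
  rw [inv_add_vecMulVec_self hV, Matrix.sub_mulVec, Matrix.smul_mulVec, Matrix.vecMulVec_mulVec]
  simp only [Matrix.mulVec_add, Matrix.mulVec_smul, add_dotProduct, dotProduct_add, smul_dotProduct,
    dotProduct_smul, smul_eq_mul, dotProduct_sub, h1, h2, hc,
    op_smul_eq_smul, MulOpposite.op_add, add_smul]
  field_simp
  ring

/-- `V ≥ c` implies `c V⁻¹ ≤ 1`. With `u = V⁻¹x` the hypothesis reads `c |u|² ≤ x·u`, and
Cauchy–Schwarz for `x·u` finishes. It bounds both the widths and the regularization bias. -/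
theorem mul_dotProduct_inv_mulVec_le {V : Matrix ι ι ℝ} (hV : V.PosDef) {c : ℝ}
    (hc : ∀ u : ι → ℝ, c * (u ⬝ᵥ u) ≤ u ⬝ᵥ V *ᵥ u) (x : ι → ℝ) :
    c * (x ⬝ᵥ V⁻¹ *ᵥ x) ≤ x ⬝ᵥ x := by
  have hu : IsUnit V.det := hV.det_pos.ne'.isUnit
  have h0 := dotProduct_mulVec_self_nonneg hV.inv x
  set u := V⁻¹ *ᵥ x with hudef
  have hVu : V *ᵥ u = x := by
    rw [hudef, Matrix.mulVec_mulVec, Matrix.mul_nonsing_inv _ hu, Matrix.one_mulVec]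
  have h1 := hc u
  rw [hVu, dotProduct_comm u x] at h1
  rcases h0.eq_or_lt with h | h
  · rw [← h, mul_zero]
    exact Finset.sum_nonneg fun i _ => mul_self_nonneg _
  have hcs : (x ⬝ᵥ u) ^ 2 ≤ (x ⬝ᵥ x) * (u ⬝ᵥ u) := by
    simpa [dotProduct, sq] using Finset.sum_mul_sq_le_sq_mul_sq Finset.univ x u
  have hxx : 0 ≤ x ⬝ᵥ x := Finset.sum_nonneg fun i _ => mul_self_nonneg _
  by_cases hc0 : c ≤ 0
  · nlinarith
  push Not at hc0
  have : (c * (x ⬝ᵥ u)) * (x ⬝ᵥ u) ≤ (x ⬝ᵥ x) * (x ⬝ᵥ u) := by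
    calc (c * (x ⬝ᵥ u)) * (x ⬝ᵥ u) = c * (x ⬝ᵥ u) ^ 2 := by ring
      _ ≤ c * ((x ⬝ᵥ x) * (u ⬝ᵥ u)) := by gcongr
      _ = (x ⬝ᵥ x) * (c * (u ⬝ᵥ u)) := by ring
      _ ≤ _ := by gcongr
  exact le_of_mul_le_mul_right this h

/-- Jensen's inequality for `log` over the eigenvalues of all matrices at once. Pooling the arms
brings in only the total trace, which can be bounded whatever the allocation of rounds to arms. -/
theorem sum_log_det_le {κ : Type*} [Fintype κ] [Nonempty κ] [Nonempty ι]
    {V : κ → Matrix ι ι ℝ} (hV : ∀ i, (V i).PosDef) :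
    ∑ i, Real.log (V i).det ≤ Fintype.card κ * Fintype.card ι *
      Real.log ((∑ i, (V i).trace) / (Fintype.card κ * Fintype.card ι)) := by
  have hN : (0 : ℝ) < Fintype.card κ * Fintype.card ι := by positivity
  have hdet : ∀ i, Real.log (V i).det = ∑ j, Real.log ((hV i).1.eigenvalues j) := by
    intro i
    rw [(hV i).1.det_eq_prod_eigenvalues, Real.log_prod]
    · simp
    · intro j _
      simpa using ((hV i).eigenvalues_pos j).ne'
  have htr : ∀ i, (V i).trace = ∑ j, (hV i).1.eigenvalues j := by
    intro i
    simpa using (hV i).1.trace_eq_sum_eigenvalues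
  simp only [hdet, htr]
  rw [← Fintype.sum_prod_type' (fun i j => Real.log ((hV i).1.eigenvalues j)),
    ← Fintype.sum_prod_type' (fun i j => (hV i).1.eigenvalues j)]
  have := strictConcaveOn_log_Ioi.concaveOn.le_map_sum (t := (Finset.univ : Finset (κ × ι)))
    (w := fun _ => ((Fintype.card κ : ℝ) * Fintype.card ι)⁻¹)
    (p := fun p => (hV p.1).1.eigenvalues p.2) (fun _ _ => by positivity)
    (by rw [Finset.sum_const, Finset.card_univ, Fintype.card_prod, nsmul_eq_mul]; push_cast
        exact mul_inv_cancel₀ hN.ne') (fun p _ => (hV p.1).eigenvalues_pos p.2)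
  simp only [smul_eq_mul, ← Finset.mul_sum] at this
  rwa [inv_mul_le_iff₀ hN, inv_mul_eq_div] at this

end LinearAlgebra

/-! ### A Gaussian mixture bound for sub-Gaussian variables -/

/-- Completing the square in `u`: a Gaussian prior times a Gaussian likelihood is a constant times
the posterior density. -/
theorem exp_mul_gaussianPDFReal (m η : ℝ) {w : ℝ} (hw : 0 < w) (u : ℝ) :
    gaussianPDFReal m w.toNNReal u * Real.exp (u * η - u ^ 2 / 2) =
      Real.exp ((2 * η * m + η ^ 2 * w - m ^ 2) / (2 * (1 + w))) / √(1 + w) *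
        gaussianPDFReal ((m + η * w) / (1 + w)) (w / (1 + w)).toNNReal u := by
  have h1 : (0 : ℝ) < 1 + w := by positivity
  have hs : √(2 * Real.pi * (w / (1 + w))) = √(2 * Real.pi * w) / √(1 + w) := by
    rw [← Real.sqrt_div (by positivity), mul_div_assoc]
  simp only [gaussianPDFReal, Real.coe_toNNReal _ hw.le,
    Real.coe_toNNReal _ (div_pos hw h1).le, hs]
  have hs1 : √(1 + w) ≠ 0 := by positivity
  have hs2 : √(2 * Real.pi * w) ≠ 0 := by positivity
  rw [mul_assoc, ← Real.exp_add]
  have : ∀ a b : ℝ, a / √(1 + w) * ((√(2 * Real.pi * w) / √(1 + w))⁻¹ * b)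
      = (√(2 * Real.pi * w))⁻¹ * (a * b) := by
    intro a b; field_simp
  rw [this, ← Real.exp_add]
  congr 2
  field_simp
  ring

/-- The integrand is the average of `exp(u X - u² / 2)` over `u` Gaussian with mean `m` and variance
`w`. By Tonelli the expectation over `X` may be taken first, and it is at most 1 for every `u` by
sub-Gaussianity. -/
theorem lintegral_exp_quadratic_le {Ω : Type*} [MeasurableSpace Ω] {P : Measure Ω}
    [IsProbabilityMeasure P] {X : Ω → ℝ} (hX : HasSubgaussianMGF X 1 P) (m : ℝ) {w : ℝ}
    (hw : 0 < w) :
    ∫⁻ ω, ENNReal.ofReal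
      (Real.exp ((2 * X ω * m + X ω ^ 2 * w - m ^ 2) / (2 * (1 + w))) / √(1 + w)) ∂P ≤ 1 := by
  have h1 : (0 : ℝ) < 1 + w := by positivity
  have hkey : ∀ η : ℝ, ENNReal.ofReal
      (Real.exp ((2 * η * m + η ^ 2 * w - m ^ 2) / (2 * (1 + w))) / √(1 + w)) =
      ∫⁻ u, ENNReal.ofReal (gaussianPDFReal m w.toNNReal u * Real.exp (u * η - u ^ 2 / 2)) := by
    intro η
    simp only [exp_mul_gaussianPDFReal m η hw]
    simp_rw [ENNReal.ofReal_mul (show 0 ≤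
      Real.exp ((2 * η * m + η ^ 2 * w - m ^ 2) / (2 * (1 + w))) / √(1 + w) by positivity)]
    rw [lintegral_const_mul _ (by fun_prop), lintegral_gaussianPDFReal_eq_one, mul_one]
    simpa using div_pos hw h1
  simp only [hkey]
  rw [lintegral_lintegral_swap]
  · calc _ ≤ ∫⁻ u, ENNReal.ofReal (gaussianPDFReal m w.toNNReal u) := by
          apply lintegral_mono
          intro u
          simp only
          have hint := hX.integrable_exp_mul u
          have hle := hX.mgf_le u
          simp_rw [ENNReal.ofReal_mul (gaussianPDFReal_nonneg m w.toNNReal u)]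
          rw [lintegral_const_mul'']
          · refine mul_le_of_le_one_right' ?_
            have he : ∀ ω, Real.exp (u * X ω - u ^ 2 / 2)
                = Real.exp (-(u ^ 2 / 2)) * Real.exp (u * X ω) := by
              intro ω; rw [← Real.exp_add]; ring_nf
            simp_rw [he]
            rw [← ofReal_integral_eq_lintegral_ofReal (hint.const_mul _)
              (ae_of_all _ fun _ => by positivity), integral_const_mul]
            rw [ENNReal.ofReal_le_one]
            have : Real.exp (-(u ^ 2 / 2)) * Real.exp (1 * u ^ 2 / 2) = 1 := by
              rw [← Real.exp_add]; simp
            rw [← this]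
            exact mul_le_mul_of_nonneg_left (by simpa [mgf] using hle) (by positivity)
          · have := hX.aemeasurable
            fun_prop
      _ = 1 := lintegral_gaussianPDFReal_eq_one m (by simpa using hw)
  · have hXm := hX.aemeasurable
    have : AEMeasurable (fun p : Ω × ℝ => X p.1) (P.prod volume) :=
      hXm.comp_quasiMeasurePreserving Measure.quasiMeasurePreserving_fst
    have h2 : Measurable (fun p : Ω × ℝ => gaussianPDFReal m w.toNNReal p.2) :=
      (measurable_gaussianPDFReal _ _).comp measurable_snd
    unfold Function.uncurry
    fun_prop

/-! ### Softmax exploration of nearly optimal arms -/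

theorem softmax_mem {K : ℕ} (S : Fin K → ℝ) (hS : ∀ i, 0 ≤ S i) {j : Fin K} (hj : S j = 0)
    (i : Fin K) :
    Real.exp (-S i) / K ≤ Real.exp (-S i) / ∑ k, Real.exp (-S k) ∧
      Real.exp (-S i) / ∑ k, Real.exp (-S k) ≤ Real.exp (-S i) := by
  have h1 : 1 ≤ ∑ k, Real.exp (-S k) := by
    calc (1 : ℝ) = Real.exp (-S j) := by simp [hj]
      _ ≤ _ := Finset.single_le_sum (f := fun k => Real.exp (-S k))
        (fun k _ => (Real.exp_pos _).le) (Finset.mem_univ j)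
  have h2 : ∑ k, Real.exp (-S k) ≤ K := by
    calc ∑ k, Real.exp (-S k) ≤ ∑ _k : Fin K, (1 : ℝ) :=
          Finset.sum_le_sum fun k _ => Real.exp_le_one_iff.2 (by linarith [hS k])
      _ = K := by simp
  exact ⟨by gcongr, div_le_self (Real.exp_pos _).le h1⟩

theorem sum_softmax_mul_gap_le {K : ℕ} {est μ w : Fin K → ℝ} {A M N : ℝ} {istar : Fin K}
    (hA : 0 < A) (hN : 1 ≤ N) (hw : ∀ i, 0 ≤ w i) (hw0 : ∀ i, w i = 0 → (⨆ j, est j) = est i)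
    (hconf : ∀ i, |est i - μ i| ≤ A * w i) (hopt : ∀ i, μ i ≤ μ istar)
    (hM : ∀ i, μ istar - μ i ≤ M) (p S : Fin K → ℝ)
    (hS : ∀ i, S i = (A ^ 2)⁻¹ * ((⨆ j, est j) - est i) ^ 2 / w i ^ 2)
    (hp : ∀ i, p i = Real.exp (-S i) / ∑ j, Real.exp (-S j)) :
    ∑ i, p i * (μ istar - μ i) ≤
      K * M / N + (√(Real.log N) + 1 + K * Real.exp 1) * A * ∑ i, p i * w i := by
  have : Nonempty (Fin K) := ⟨istar⟩
  have hK : (0 : ℝ) < K := by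
    have := Fin.pos istar
    exact_mod_cast this
  obtain ⟨b, hb⟩ := exists_eq_ciSup_of_finite (f := est)
  have hE : ∀ i, 0 ≤ (⨆ j, est j) - est i := fun i =>
    sub_nonneg.2 (le_ciSup (Set.finite_range est).bddAbove i)
  have hS0 : ∀ i, 0 ≤ S i := fun i => by rw [hS]; positivity
  have hSb : S b = 0 := by rw [hS, hb, sub_self]; simp
  -- The score inverted: an estimated gap is `√(S i)` confidence widths. At zero width the score is
  -- `0` by division by zero, and `hw0` supplies the identity.
  have hES : ∀ i, (⨆ j, est j) - est i = A * w i * √(S i) := by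
    intro i
    rcases (hw i).eq_or_lt with h | h
    · rw [hw0 i h.symm, ← h]; simp
    · have : S i = (((⨆ j, est j) - est i) / (A * w i)) ^ 2 := by
        rw [hS]; field_simp
      rw [this, Real.sqrt_sq (div_nonneg (hE i) (by positivity))]
      field_simp
  have hp0 : ∀ i, 0 ≤ p i := fun i => by
    rw [hp]; exact div_nonneg (Real.exp_pos _).le (Finset.sum_nonneg fun j _ => (Real.exp_pos _).le)
  have hpsum : ∑ i, p i = 1 := by
    simp only [hp, ← Finset.sum_div]
    exact div_self (Finset.sum_pos (fun i _ => Real.exp_pos _) Finset.univ_nonempty).ne'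
  have hple : ∀ i, p i ≤ Real.exp (-S i) := fun i => by
    rw [hp]; exact (softmax_mem S hS0 hSb i).2
  have hpge : ∀ i, Real.exp (-S i) / K ≤ p i := fun i => by
    rw [hp]; exact (softmax_mem S hS0 hSb i).1
  have hgap0 : ∀ i, 0 ≤ μ istar - μ i := fun i => sub_nonneg.2 (hopt i)
  have hM0 : 0 ≤ M := (hgap0 b).trans (hM b)
  have hNlog : 0 ≤ Real.log N := Real.log_nonneg hN
  have hsum0 : 0 ≤ ∑ i, p i * w i := Finset.sum_nonneg fun i _ => mul_nonneg (hp0 i) (hw i)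
  -- `B` is the price of the uncertainty about the optimal arm: its confidence width if its score is
  -- at most 1, and `0` otherwise.
  obtain ⟨B, hB0, hBle, hB⟩ : ∃ B, 0 ≤ B ∧ B ≤ K * Real.exp 1 * A * ∑ i, p i * w i ∧
      ∀ i, μ istar - μ i ≤ A * w i * √(S i) + A * w i + B := by
    by_cases h : S istar ≤ 1
    · refine ⟨A * w istar, mul_nonneg hA.le (hw _), ?_, fun i => ?_⟩
      · have h1 : 1 ≤ K * Real.exp 1 * p istar := by
          have h2 : Real.exp (-1) / K ≤ p istar :=
            (by gcongr : Real.exp (-1) / K ≤ Real.exp (-S istar) / K).trans (hpge istar)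
          calc (1 : ℝ) = K * Real.exp 1 * (Real.exp (-1) / K) := by
                rw [Real.exp_neg]; field_simp
            _ ≤ _ := by gcongr
        have h3 : p istar * w istar ≤ ∑ i, p i * w i :=
          Finset.single_le_sum (f := fun i => p i * w i)
            (fun i _ => mul_nonneg (hp0 i) (hw i)) (Finset.mem_univ _)
        calc A * w istar ≤ A * w istar * (K * Real.exp 1 * p istar) :=
              le_mul_of_one_le_right (mul_nonneg hA.le (hw _)) h1
          _ = K * Real.exp 1 * A * (p istar * w istar) := by ring
          _ ≤ _ := by gcongr
      · have h1 := abs_le.1 (hconf i)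
        have h2 := abs_le.1 (hconf istar)
        have h3 := hES i
        have h4 := hE istar
        linarith
    -- With score above 1 the optimal arm's estimate lies more than its confidence width below the
    -- maximum, so the maximal estimate is at least the optimal mean.
    · refine ⟨0, le_rfl, by positivity, fun i => ?_⟩
      have h1 := abs_le.1 (hconf i)
      have h2 := abs_le.1 (hconf istar)
      have h3 := hES i
      have h4 := hES istar
      have h5 : 1 ≤ √(S istar) := Real.one_le_sqrt.2 (not_le.1 h).le
      have h6 : A * w istar ≤ A * w istar * √(S istar) :=
        le_mul_of_one_le_right (mul_nonneg hA.le (hw _)) h5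
      linarith
  have hterm : ∀ i, p i * (μ istar - μ i) ≤
      M / N + ((√(Real.log N) + 1) * A * (p i * w i) + p i * B) := by
    intro i
    have hr : 0 ≤ (√(Real.log N) + 1) * A * (p i * w i) + p i * B := by
      have := hp0 i
      have := hw i
      positivity
    -- Arms with score at least `log N` are pulled with probability at most `1 / N`; for the others
    -- `√(S i)` is at most `√(log N)`.
    rcases le_total (Real.log N) (S i) with h | h
    · have hpN : p i ≤ 1 / N := by
        refine (hple i).trans ?_
        rw [one_div, ← Real.exp_log (show 0 < N by linarith), ← Real.exp_neg]
        gcongr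
      have : p i * (μ istar - μ i) ≤ 1 / N * M := by
        have := hgap0 i
        have := hM i
        gcongr
      have h' : 1 / N * M = M / N := by ring
      linarith
    · have h1 : √(S i) ≤ √(Real.log N) := Real.sqrt_le_sqrt h
      have h2 : μ istar - μ i ≤ A * w i * √(Real.log N) + A * w i + B := by
        refine (hB i).trans ?_
        have := mul_nonneg hA.le (hw i)
        gcongr
      have h3 := mul_le_mul_of_nonneg_left h2 (hp0 i)
      have h4 : 0 ≤ M / N := by positivity
      calc _ ≤ _ := h3
        _ = (√(Real.log N) + 1) * A * (p i * w i) + p i * B := by ring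
        _ ≤ _ := by linarith
  calc ∑ i, p i * (μ istar - μ i)
      ≤ ∑ i, (M / N + ((√(Real.log N) + 1) * A * (p i * w i) + p i * B)) :=
        Finset.sum_le_sum fun i _ => hterm i
    _ = K * M / N + (√(Real.log N) + 1) * A * (∑ i, p i * w i) + B := by
        simp only [Finset.sum_add_distrib, ← Finset.mul_sum, ← Finset.sum_mul, hpsum]
        simp
        ring
    _ ≤ _ := by linarith

/-! ### Deterministic properties of the estimates -/

section Estimates

variable {d K : ℕ} {x : ℕ → EuclideanSpace ℝ (Fin d)} {θ : Fin K → EuclideanSpace ℝ (Fin d)}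
  {lam : ℝ}

@[simp] theorem proj_one (t : ℕ) : proj 1 x t = (x t).ofLp := by simp [proj]

theorem dotProduct_ofLp_self (v : EuclideanSpace ℝ (Fin d)) :
    v.ofLp ⬝ᵥ v.ofLp = ‖v‖ ^ 2 := by
  rw [EuclideanSpace.real_norm_sq_eq]
  simp [dotProduct, sq]

theorem linMean_eq_dotProduct (t : ℕ) (i : Fin K) :
    linMean x θ t i = (x t).ofLp ⬝ᵥ (θ i).ofLp := by
  simp [linMean, PiLp.inner_apply, dotProduct, mul_comm]

/-- The noise accumulated in the least-squares estimate of arm `i`. -/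
noncomputable def noiseSum (x : ℕ → EuclideanSpace ℝ (Fin d))
    (θ : Fin K → EuclideanSpace ℝ (Fin d)) (t : ℕ) (h : History K t) (i : Fin K) : Fin d → ℝ :=
  ∑ s : Fin t, if (h s).1 = i then ((h s).2 - linMean x θ s i) • (x s).ofLp else 0

/-- The total squared self-normalized noise of all arms. -/
noncomputable def noiseEnergy (x : ℕ → EuclideanSpace ℝ (Fin d))
    (θ : Fin K → EuclideanSpace ℝ (Fin d)) (lam : ℝ) (t : ℕ) (h : History K t) : ℝ :=
  ∑ i, noiseSum x θ t h i ⬝ᵥ (gram 1 x lam t h i)⁻¹ *ᵥ noiseSum x θ t h i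

/-- The information gain: the total log-determinant of the Gram matrices relative to `lam • 1`. -/
noncomputable def infoGain (K : ℕ) (x : ℕ → EuclideanSpace ℝ (Fin d)) (lam : ℝ) (t : ℕ)
    (h : History K t) : ℝ :=
  ∑ i, Real.log ((gram 1 x lam t h i).det / lam ^ d)

/-- The squared width `x_tᵀ G_i⁻¹ x_t` of arm `i` in round `t`. -/
noncomputable def sqWidth (x : ℕ → EuclideanSpace ℝ (Fin d)) (lam : ℝ) (t : ℕ)
    (h : History K t) (i : Fin K) : ℝ :=
  (x t).ofLp ⬝ᵥ (gram 1 x lam t h i)⁻¹ *ᵥ (x t).ofLp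

theorem gram_zero (h : History K 0) (i : Fin K) :
    gram 1 x lam 0 h i = lam • (1 : Matrix (Fin d) (Fin d) ℝ) := by
  simp [gram]

theorem gram_succ (t : ℕ) (h : History K (t + 1)) (i : Fin K) :
    gram 1 x lam (t + 1) h i = gram 1 x lam t (fun s => h s.castSucc) i +
      if (h (Fin.last t)).1 = i then Matrix.vecMulVec (x t).ofLp (x t).ofLp else 0 := by
  simp only [gram, Fin.sum_univ_castSucc, proj_one, Fin.val_castSucc, Fin.val_last]
  abel

theorem noiseSum_succ (t : ℕ) (h : History K (t + 1)) (i : Fin K) :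
    noiseSum x θ (t + 1) h i = noiseSum x θ t (fun s => h s.castSucc) i +
      if (h (Fin.last t)).1 = i then
        ((h (Fin.last t)).2 - linMean x θ t i) • (x t).ofLp else 0 := by
  simp only [noiseSum, Fin.sum_univ_castSucc, Fin.val_castSucc, Fin.val_last]

theorem dotProduct_gram_mulVec (t : ℕ) (h : History K t) (i : Fin K) (u : Fin d → ℝ) :
    u ⬝ᵥ gram 1 x lam t h i *ᵥ u =
      (∑ s : Fin t, if (h s).1 = i then ((x s).ofLp ⬝ᵥ u) ^ 2 else 0) + lam * (u ⬝ᵥ u) := by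
  simp only [gram, proj_one, Matrix.add_mulVec, Matrix.sum_mulVec, dotProduct_add, dotProduct_sum,
    Matrix.smul_mulVec, Matrix.one_mulVec, dotProduct_smul, smul_eq_mul]
  congr 1
  refine Finset.sum_congr rfl fun s _ => ?_
  split_ifs
  · rw [Matrix.vecMulVec_mulVec, op_smul_eq_smul, dotProduct_smul, smul_eq_mul, dotProduct_comm u,
      sq]
  · simp

theorem le_dotProduct_gram_mulVec (t : ℕ) (h : History K t) (i : Fin K) (u : Fin d → ℝ) :
    lam * (u ⬝ᵥ u) ≤ u ⬝ᵥ gram 1 x lam t h i *ᵥ u := by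
  rw [dotProduct_gram_mulVec]
  refine le_add_of_nonneg_left (Finset.sum_nonneg fun s _ => ?_)
  split_ifs <;> positivity

theorem gram_posDef (hlam : 0 < lam) (t : ℕ) (h : History K t) (i : Fin K) :
    (gram 1 x lam t h i).PosDef := by
  induction t with
  | zero => rw [gram_zero]; exact Matrix.PosDef.one.smul hlam
  | succ t ih =>
    rw [gram_succ]
    refine (ih _).add_posSemidef ?_
    split_ifs
    · simpa using Matrix.posSemidef_vecMulVec_self_star (x t).ofLp
    · exact Matrix.PosSemidef.zero

theorem sqWidth_nonneg (hlam : 0 < lam) (t : ℕ) (h : History K t) (i : Fin K) :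
    0 ≤ sqWidth x lam t h i :=
  dotProduct_mulVec_self_nonneg (gram_posDef hlam t h i).inv _

theorem mul_sqWidth_le (hlam : 0 < lam) (t : ℕ) (h : History K t) (i : Fin K) :
    lam * sqWidth x lam t h i ≤ ‖x t‖ ^ 2 := by
  rw [← dotProduct_ofLp_self]
  exact mul_dotProduct_inv_mulVec_le (gram_posDef hlam t h i) (le_dotProduct_gram_mulVec t h i) _

theorem eq_zero_of_sqWidth_eq_zero (hlam : 0 < lam) {t : ℕ} {h : History K t} {i : Fin K}
    (h0 : sqWidth x lam t h i = 0) : (x t).ofLp = 0 := by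
  by_contra hx
  have := (gram_posDef (x := x) hlam t h i).inv.dotProduct_mulVec_pos hx
  simp only [star_trivial] at this
  exact this.ne' h0

theorem infoGain_zero (hlam : 0 < lam) (h : History K 0) : infoGain K x lam 0 h = 0 := by
  simp [infoGain, gram_zero, hlam.ne']

/-- Only the pulled arm's matrix changes, and the matrix determinant lemma multiplies its
determinant by one plus the squared width. -/
theorem infoGain_succ (hlam : 0 < lam) (t : ℕ) (h : History K (t + 1)) :
    infoGain K x lam (t + 1) h = infoGain K x lam t (fun s => h s.castSucc) +
      Real.log (1 + sqWidth x lam t (fun s => h s.castSucc) (h (Fin.last t)).1) := by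
  set a := (h (Fin.last t)).1
  simp only [infoGain]
  rw [← Finset.add_sum_erase _ _ (Finset.mem_univ a),
    ← Finset.add_sum_erase (a := a) _ (fun i => Real.log
      ((gram 1 x lam t (fun s => h s.castSucc) i).det / lam ^ d)) (Finset.mem_univ a)]
  have hdet := (gram_posDef (x := x) hlam t (fun s => h s.castSucc) a).det_pos
  have hw := sqWidth_nonneg (x := x) hlam t (fun s => h s.castSucc) a
  have h1 : ∑ i ∈ Finset.univ.erase a, Real.log ((gram 1 x lam (t + 1) h i).det / lam ^ d) =
      ∑ i ∈ Finset.univ.erase a,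
        Real.log ((gram 1 x lam t (fun s => h s.castSucc) i).det / lam ^ d) := by
    refine Finset.sum_congr rfl fun i hi => ?_
    rw [gram_succ, if_neg (Finset.ne_of_mem_erase hi).symm, add_zero]
  rw [h1, gram_succ, if_pos rfl, det_add_vecMulVec_self (gram_posDef hlam _ _ _),
    mul_div_right_comm, Real.log_mul (by positivity)]
  · unfold sqWidth; ring
  · unfold sqWidth at hw; positivity

/-- Only the pulled arm contributes a change, given by `quadForm_rank_one_update`. The increment
involves the new noise `η`, the squared width `w` and the past noise `m` projected on the context.
-/
theorem noiseEnergy_succ (hlam : 0 < lam) (t : ℕ) (h : History K (t + 1)) (a : Fin K) (η w m : ℝ)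
    (ha : a = (h (Fin.last t)).1) (hη : η = (h (Fin.last t)).2 - linMean x θ t a)
    (hw : w = sqWidth x lam t (fun s => h s.castSucc) a)
    (hm : m = (x t).ofLp ⬝ᵥ (gram 1 x lam t (fun s => h s.castSucc) a)⁻¹ *ᵥ
      noiseSum x θ t (fun s => h s.castSucc) a) :
    noiseEnergy x θ lam (t + 1) h = noiseEnergy x θ lam t (fun s => h s.castSucc) +
      (2 * η * m + η ^ 2 * w - m ^ 2) / (1 + w) := by
  simp only [noiseEnergy]
  rw [← Finset.add_sum_erase _ _ (Finset.mem_univ a),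
    ← Finset.add_sum_erase (a := a) _ (fun i => noiseSum x θ t (fun s => h s.castSucc) i ⬝ᵥ
      (gram 1 x lam t (fun s => h s.castSucc) i)⁻¹ *ᵥ noiseSum x θ t (fun s => h s.castSucc) i)
      (Finset.mem_univ a)]
  have h1 : ∑ i ∈ Finset.univ.erase a, noiseSum x θ (t + 1) h i ⬝ᵥ
        (gram 1 x lam (t + 1) h i)⁻¹ *ᵥ noiseSum x θ (t + 1) h i =
      ∑ i ∈ Finset.univ.erase a, noiseSum x θ t (fun s => h s.castSucc) i ⬝ᵥ
      (gram 1 x lam t (fun s => h s.castSucc) i)⁻¹ *ᵥ noiseSum x θ t (fun s => h s.castSucc) i := by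
    refine Finset.sum_congr rfl fun i hi => ?_
    have : ¬ (h (Fin.last t)).1 = i := by
      rw [← ha]; exact (Finset.ne_of_mem_erase hi).symm
    rw [gram_succ, noiseSum_succ, if_neg this, if_neg this, add_zero, add_zero]
  rw [h1, gram_succ, noiseSum_succ, if_pos ha.symm, if_pos ha.symm,
    quadForm_rank_one_update (gram_posDef hlam _ _ _), ← hη, ← hm]
  have : (x t).ofLp ⬝ᵥ (gram 1 x lam t (fun s => h s.castSucc) a)⁻¹ *ᵥ (x t).ofLp = w := hw.symm
  rw [this]
  ring

theorem noiseEnergy_zero (h : History K 0) : noiseEnergy x θ lam 0 h = 0 := by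
  simp [noiseEnergy, noiseSum]

theorem sum_trace_gram_le {t : ℕ} {L : ℝ} (hL : ∀ s < t, ‖x s‖ ≤ L) (h : History K t) :
    ∑ i, (gram 1 x lam t h i).trace ≤ t * L ^ 2 + K * d * lam := by
  have htr : ∀ i, (gram 1 x lam t h i).trace =
      (∑ s : Fin t, if (h s).1 = i then ‖x s‖ ^ 2 else 0) + d * lam := by
    intro i
    simp only [gram, proj_one, Matrix.trace_add, Matrix.trace_sum, Matrix.trace_smul,
      Matrix.trace_one, Fintype.card_fin, smul_eq_mul]
    rw [mul_comm]
    congr 1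
    refine Finset.sum_congr rfl fun s _ => ?_
    split_ifs
    · rw [Matrix.trace_vecMulVec, dotProduct_ofLp_self]
    · simp
  simp only [htr, Finset.sum_add_distrib]
  -- Each round belongs to exactly one arm, so its context is counted once in the sum over arms.
  rw [Finset.sum_comm]
  simp only [Finset.sum_ite_eq, Finset.mem_univ, if_true, Finset.sum_const, Finset.card_univ,
    Fintype.card_fin, nsmul_eq_mul, mul_assoc]
  gcongr
  calc ∑ s : Fin t, ‖x s‖ ^ 2 ≤ ∑ _s : Fin t, L ^ 2 :=
        Finset.sum_le_sum fun s _ => by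
          have := hL s s.2
          gcongr
    _ = t * L ^ 2 := by simp

theorem infoGain_le (hK : 0 < K) (hd : 0 < d) (hlam : 0 < lam) {t n : ℕ} (htn : t ≤ n) {L : ℝ}
    (hL : ∀ s < t, ‖x s‖ ≤ L) (h : History K t) :
    infoGain K x lam t h ≤ K * d * Real.log (1 + n * L ^ 2 / (K * d * lam)) := by
  have : Nonempty (Fin K) := ⟨⟨0, hK⟩⟩
  have : Nonempty (Fin d) := ⟨⟨0, hd⟩⟩
  have hK' : (0 : ℝ) < K := by exact_mod_cast hK
  have hd' : (0 : ℝ) < d := by exact_mod_cast hd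
  have hpd := fun i => gram_posDef (x := x) hlam t h i
  have h1 := sum_log_det_le hpd
  simp only [Fintype.card_fin] at h1
  have h2 : infoGain K x lam t h =
      ∑ i, Real.log (gram 1 x lam t h i).det - K * d * Real.log lam := by
    simp only [infoGain]
    rw [Finset.sum_congr rfl fun i _ => Real.log_div (hpd i).det_pos.ne' (by positivity)]
    simp [Finset.sum_sub_distrib, mul_assoc]
  have htr0 : 0 < ∑ i, (gram 1 x lam t h i).trace :=
    Finset.sum_pos (fun i _ => (hpd i).trace_pos) Finset.univ_nonempty
  have h3 : (∑ i, (gram 1 x lam t h i).trace) / (K * d) ≤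
      lam * (1 + n * L ^ 2 / (K * d * lam)) := by
    rw [div_le_iff₀ (by positivity)]
    calc _ ≤ t * L ^ 2 + K * d * lam := sum_trace_gram_le hL h
      _ ≤ n * L ^ 2 + K * d * lam := by gcongr
      _ = _ := by field_simp; ring
  have h4 := Real.log_le_log (by positivity) h3
  rw [Real.log_mul hlam.ne' (by positivity)] at h4
  have h5 : (0 : ℝ) ≤ K * d := by positivity
  have h6 := mul_le_mul_of_nonneg_left h4 h5
  rw [h2]
  linarith

theorem le_two_mul_log_one_add {w : ℝ} (h0 : 0 ≤ w) (h1 : w ≤ 1) : w ≤ 2 * Real.log (1 + w) := by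
  have h := Real.one_sub_inv_le_log_of_pos (show 0 < 1 + w by linarith)
  have h2 : w / 2 ≤ 1 - (1 + w)⁻¹ := by
    have : 1 - (1 + w)⁻¹ = w / (1 + w) := by field_simp; ring
    rw [this]
    gcongr
    linarith
  linarith

/-- The elliptical potential lemma. -/
theorem sum_sqWidth_le {Ω : Type*} (hlam : 0 < lam) (I : ℕ → Ω → Fin K)
    (Y : ℕ → Ω → Fin K → ℝ) (ω : Ω) (n : ℕ) (hx : ∀ t < n, ‖x t‖ ^ 2 ≤ lam) :
    ∑ t ∈ Finset.range n, sqWidth x lam t (history I Y t ω) (I t ω) ≤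
      2 * infoGain K x lam n (history I Y n ω) := by
  induction n with
  | zero => simp [infoGain_zero hlam]
  | succ n ih =>
    rw [Finset.sum_range_succ, infoGain_succ hlam]
    have h1 := ih fun t ht => hx t (ht.trans n.lt_succ_self)
    have h0 := sqWidth_nonneg (x := x) hlam n (history I Y n ω) (I n ω)
    -- Regularization by at least `‖x n‖²` keeps squared widths below 1, where `w ≤ 2 log (1 + w)`
    -- is available.
    have h2 : sqWidth x lam n (history I Y n ω) (I n ω) ≤ 1 := by
      have := (mul_sqWidth_le (x := x) hlam n (history I Y n ω) (I n ω)).trans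
        (hx n n.lt_succ_self)
      nlinarith
    have h3 := le_two_mul_log_one_add h0 h2
    have e1 : (fun s : Fin n => history I Y (n + 1) ω s.castSucc) = history I Y n ω := rfl
    have e2 : (history I Y (n + 1) ω (Fin.last n)).1 = I n ω := by simp [history]
    rw [e1, e2]
    linarith

/-- Each reward is noise plus `x_sᵀθ_i`, and the contexts of arm `i` have second-moment matrix `G -
λ`. Applying `G⁻¹` leaves `θ_i` plus the noise and bias terms. -/
theorem sum_rewards_eq (t : ℕ) (h : History K t) (i : Fin K) :
    (∑ s : Fin t, if (h s).1 = i then (h s).2 • (x s).ofLp else 0) =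
      noiseSum x θ t h i + (gram 1 x lam t h i *ᵥ (θ i).ofLp - lam • (θ i).ofLp) := by
  simp only [gram, noiseSum, proj_one, Matrix.add_mulVec, Matrix.sum_mulVec, Matrix.smul_mulVec,
    Matrix.one_mulVec, add_sub_cancel_right, ← Finset.sum_add_distrib]
  refine Finset.sum_congr rfl fun s _ => ?_
  split_ifs
  · rw [Matrix.vecMulVec_mulVec, op_smul_eq_smul, ← linMean_eq_dotProduct, ← add_smul,
      sub_add_cancel]
  · simp

theorem wnorm_gram_inv (t : ℕ) (h : History K t) (i : Fin K) :
    wnorm (gram 1 x lam t h i)⁻¹ (proj 1 x t) = √(sqWidth x lam t h i) := by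
  simp [wnorm, sqWidth]

/-- The error is `xᵀG⁻¹S - λ xᵀG⁻¹θ`; both terms are bounded by Cauchy–Schwarz for the form `G⁻¹`.
The arm's noise is bounded by the total energy, so one event serves all arms, and `G ≥ λ` bounds the
bias. -/
theorem abs_estMean_sub_linMean_le (hlam : 0 < lam) (t : ℕ) (h : History K t) (i : Fin K) :
    |estMean 1 x lam t h i - linMean x θ t i| ≤
      (√(noiseEnergy x θ lam t h) + √lam * paramLength θ) * √(sqWidth x lam t h i) := by
  have hG := gram_posDef (x := x) hlam t h i
  set G := gram 1 x lam t h i with hGdef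
  set S := noiseSum x θ t h i with hSdef
  have hest : estMean 1 x lam t h i - linMean x θ t i =
      (x t).ofLp ⬝ᵥ G⁻¹ *ᵥ S - lam * ((x t).ofLp ⬝ᵥ G⁻¹ *ᵥ (θ i).ofLp) := by
    simp only [estMean, estimate, proj_one]
    rw [sum_rewards_eq (θ := θ) (lam := lam), Matrix.mulVec_add, Matrix.mulVec_sub,
      Matrix.mulVec_mulVec, ← hGdef, Matrix.nonsing_inv_mul _ hG.det_pos.ne'.isUnit,
      Matrix.one_mulVec, linMean_eq_dotProduct]
    simp only [dotProduct_add, dotProduct_sub, Matrix.mulVec_smul, dotProduct_smul, smul_eq_mul]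
    ring
  have hw0 := sqWidth_nonneg (x := x) hlam t h i
  have h1 : |(x t).ofLp ⬝ᵥ G⁻¹ *ᵥ S| ≤ √(sqWidth x lam t h i) * √(noiseEnergy x θ lam t h) := by
    rw [← Real.sqrt_mul hw0, ← Real.sqrt_sq_eq_abs]
    refine Real.sqrt_le_sqrt ((dotProduct_mulVec_sq_le hG.inv _ _).trans ?_)
    refine mul_le_mul_of_nonneg_left ?_ hw0
    exact Finset.single_le_sum (f := fun j => noiseSum x θ t h j ⬝ᵥ
      (gram 1 x lam t h j)⁻¹ *ᵥ noiseSum x θ t h j)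
      (fun j _ => dotProduct_mulVec_self_nonneg (gram_posDef hlam t h j).inv _) (Finset.mem_univ i)
  have h2 : |lam * ((x t).ofLp ⬝ᵥ G⁻¹ *ᵥ (θ i).ofLp)| ≤
      √(sqWidth x lam t h i) * (√lam * paramLength θ) := by
    rw [paramLength, ← Real.sqrt_mul hlam.le, ← Real.sqrt_mul hw0, ← Real.sqrt_sq_eq_abs]
    refine Real.sqrt_le_sqrt ?_
    have ha := dotProduct_mulVec_sq_le hG.inv (x t).ofLp (θ i).ofLp
    have hb := mul_dotProduct_inv_mulVec_le hG (le_dotProduct_gram_mulVec t h i) (θ i).ofLp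
    rw [dotProduct_ofLp_self] at hb
    have hc : ‖θ i‖ ^ 2 ≤ ∑ j, ‖θ j‖ ^ 2 :=
      Finset.single_le_sum (f := fun j => ‖θ j‖ ^ 2) (fun j _ => by positivity)
        (Finset.mem_univ i)
    calc (lam * ((x t).ofLp ⬝ᵥ G⁻¹ *ᵥ (θ i).ofLp)) ^ 2
        = lam ^ 2 * ((x t).ofLp ⬝ᵥ G⁻¹ *ᵥ (θ i).ofLp) ^ 2 := by ring
      _ ≤ lam ^ 2 * (sqWidth x lam t h i * ((θ i).ofLp ⬝ᵥ G⁻¹ *ᵥ (θ i).ofLp)) := by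
          gcongr; exact ha
      _ = sqWidth x lam t h i * (lam * (lam * ((θ i).ofLp ⬝ᵥ G⁻¹ *ᵥ (θ i).ofLp))) := by ring
      _ ≤ _ := by gcongr; exact hb.trans hc
  rw [hest]
  calc _ ≤ _ := abs_sub _ _
    _ ≤ _ := add_le_add h1 h2
    _ = _ := by ring

end Estimates

/-! ### Measurability of functions of the history -/

section Measurability

variable {d K : ℕ} {x : ℕ → EuclideanSpace ℝ (Fin d)} {θ : Fin K → EuclideanSpace ℝ (Fin d)}
  {lam : ℝ}

theorem measurable_of_arms {α β γ : Type*} [MeasurableSpace α] [MeasurableSpace β]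
    [MeasurableSpace γ] {f : (α × Fin K) × β → γ}
    (h : ∀ a, Measurable fun p : α × β => f ((p.1, a), p.2)) : Measurable f := by
  have h1 : Measurable (fun q : (α × β) × Fin K => f ((q.1.1, q.2), q.1.2)) :=
    measurable_from_prod_countable_left h
  exact h1.comp
    (by fun_prop : Measurable fun q : (α × Fin K) × β => ((q.1.1, q.2), q.1.2))

/-- Gram matrices depend on the pulled arms only, and there are finitely many arm sequences, so no
measurability of matrix inversion is needed. In the uses below the rewards are replaced by the dummy
value `0`. -/
theorem measurable_arms_comp {β : Type*} [MeasurableSpace β] {t : ℕ} (F : (Fin t → Fin K) → β) :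
    Measurable fun h : History K t => F fun s => (h s).1 :=
  (measurable_of_countable F).comp (by fun_prop)

theorem measurable_gram_inv (t : ℕ) (i : Fin K) (a b : Fin d) :
    Measurable fun h : History K t => (gram 1 x lam t h i)⁻¹ a b :=
  measurable_arms_comp fun v : Fin t → Fin K =>
    (gram 1 x lam t (fun s => (v s, (0 : ℝ))) i)⁻¹ a b

theorem measurable_infoGain (t : ℕ) : Measurable fun h : History K t => infoGain K x lam t h :=
  measurable_arms_comp fun v : Fin t → Fin K => infoGain K x lam t (fun s => (v s, (0 : ℝ)))

theorem measurable_sqWidth (t : ℕ) (i : Fin K) :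
    Measurable fun h : History K t => sqWidth x lam t h i :=
  measurable_arms_comp fun v : Fin t → Fin K => sqWidth x lam t (fun s => (v s, (0 : ℝ))) i

theorem measurable_noiseSum (t : ℕ) (i : Fin K) :
    Measurable fun h : History K t => noiseSum x θ t h i := by
  refine Finset.measurable_fun_sum _ fun s _ => Measurable.ite ?_ ?_ measurable_const
  · exact (by fun_prop : Measurable fun h : History K t => (h s).1) (measurableSet_singleton i)
  · fun_prop

theorem measurable_dotProduct_gram_inv {α : Type*} [MeasurableSpace α] (t : ℕ) (i : Fin K)
    {g : α → History K t} (hg : Measurable g) {u v : α → Fin d → ℝ} (hu : Measurable u)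
    (hv : Measurable v) : Measurable fun p => u p ⬝ᵥ (gram 1 x lam t (g p) i)⁻¹ *ᵥ v p := by
  simp only [dotProduct, Matrix.mulVec]
  exact Finset.measurable_fun_sum _ fun a _ => (measurable_pi_iff.1 hu a).mul
    (Finset.measurable_fun_sum _ fun b _ =>
      ((measurable_gram_inv t i a b).comp hg).mul (measurable_pi_iff.1 hv b))

theorem measurable_noiseEnergy (t : ℕ) :
    Measurable fun h : History K t => noiseEnergy x θ lam t h :=
  Finset.measurable_fun_sum _ fun i _ => measurable_dotProduct_gram_inv t i measurable_id
    (measurable_noiseSum t i) (measurable_noiseSum t i)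

end Measurability

/-! ### Interactions -/

section Interaction

variable {Ω : Type*} [MeasurableSpace Ω] {P : Measure Ω} {K n : ℕ} {f : ℕ → Fin K → ℝ} {σ : ℝ≥0}
  {π : Policy K} {I : ℕ → Ω → Fin K} {Y : ℕ → Ω → Fin K → ℝ}

/-- Turns evaluation at a random arm into a finite sum of indicators times fixed coordinates, to
which integrability and independence apply. -/
theorem apply_arm_eq_sum (y : Fin K → ℝ) (a : Fin K) :
    y a = ∑ i, (if a = i then (1 : ℝ) else 0) * y i := by
  simp

theorem IsInteraction.measurable_armIndicator (hI : IsInteraction P n f σ π I Y) {t : ℕ}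
    (ht : t < n) (i : Fin K) : Measurable fun ω => if I t ω = i then (1 : ℝ) else 0 :=
  Measurable.ite (hI.measurable_arm t ht (measurableSet_singleton i)) measurable_const
    measurable_const

theorem IsInteraction.measurable_observed (hI : IsInteraction P n f σ π I Y) {t : ℕ}
    (ht : t < n) : Measurable fun ω => Y t ω (I t ω) := by
  have h1 := hI.measurable_armIndicator ht
  have h2 := hI.measurable_reward t ht
  have : (fun ω => Y t ω (I t ω)) =
      fun ω => ∑ i, (if I t ω = i then (1 : ℝ) else 0) * Y t ω i :=
    funext fun ω => apply_arm_eq_sum (Y t ω) (I t ω)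
  rw [this]
  fun_prop

theorem IsInteraction.measurable_history (hI : IsInteraction P n f σ π I Y) {t : ℕ}
    (ht : t ≤ n) : Measurable (history I Y t) := by
  refine measurable_pi_iff.2 fun s => ?_
  exact (hI.measurable_arm s (s.2.trans_le ht)).prodMk (hI.measurable_observed (s.2.trans_le ht))

theorem IsInteraction.integrable_reward [IsProbabilityMeasure P]
    (hI : IsInteraction P n f σ π I Y) {t : ℕ} (ht : t < n) (i : Fin K) :
    Integrable (fun ω => Y t ω i) P := by
  have := (hI.subgaussian_reward t ht i).integrable.add (integrable_const (f t i))
  simpa [Pi.add_def] using this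

theorem integrable_armIndicator_mul [IsProbabilityMeasure P]
    (hI : IsInteraction P n f σ π I Y) {t : ℕ} (ht : t < n) (i : Fin K) {g : Ω → ℝ}
    (hg : Integrable g P) : Integrable (fun ω => (if I t ω = i then (1 : ℝ) else 0) * g ω) P :=
  hg.bdd_mul (c := 1) (hI.measurable_armIndicator ht i).aestronglyMeasurable
    (ae_of_all _ fun ω => by split_ifs <;> simp)

theorem IsInteraction.integrable_observed [IsProbabilityMeasure P]
    (hI : IsInteraction P n f σ π I Y) {t : ℕ} (ht : t < n) :
    Integrable (fun ω => Y t ω (I t ω)) P := by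
  simp_rw [fun ω => apply_arm_eq_sum (Y t ω) (I t ω)]
  exact integrable_finsetSum _ fun i _ =>
    integrable_armIndicator_mul hI ht i (hI.integrable_reward ht i)

theorem IsInteraction.integral_observed [IsProbabilityMeasure P]
    (hI : IsInteraction P n f σ π I Y) {t : ℕ} (ht : t < n) :
    ∫ ω, Y t ω (I t ω) ∂P = ∫ ω, f t (I t ω) ∂P := by
  simp_rw [fun ω => apply_arm_eq_sum (Y t ω) (I t ω),
    fun ω => apply_arm_eq_sum (f t) (I t ω)]
  rw [integral_finsetSum _ fun i _ =>
      integrable_armIndicator_mul hI ht i (hI.integrable_reward ht i),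
    integral_finsetSum _ fun i _ =>
      integrable_armIndicator_mul hI ht i (integrable_const (f t i))]
  refine Finset.sum_congr rfl fun i _ => ?_
  have hind : IndepFun (fun ω => if I t ω = i then (1 : ℝ) else 0) (fun ω => Y t ω i) P := by
    refine (hI.indep_reward t ht).comp
      (φ := fun p : History K t × Fin K => if p.2 = i then (1 : ℝ) else 0)
      (ψ := fun y : Fin K → ℝ => y i) ?_ (measurable_pi_apply i)
    exact Measurable.ite (measurable_snd (measurableSet_singleton i)) measurable_const
      measurable_const
  rw [hind.integral_fun_mul_eq_mul_integral
    (hI.measurable_armIndicator ht i).aestronglyMeasurable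
    (hI.integrable_reward ht i).aestronglyMeasurable, hI.mean_reward t ht i, integral_mul_const]

theorem IsInteraction.integrable_realizedRegret [IsProbabilityMeasure P]
    (hI : IsInteraction P n f σ π I Y) (istar : ℕ → Fin K) :
    Integrable (realizedRegret n istar I Y) P := by
  unfold realizedRegret
  exact integrable_finsetSum _ fun t ht => (hI.integrable_reward (Finset.mem_range.1 ht) _).sub
    (hI.integrable_observed (Finset.mem_range.1 ht))

theorem IsInteraction.integrable_arm_comp [IsProbabilityMeasure P]
    (hI : IsInteraction P n f σ π I Y) {t : ℕ} (ht : t < n) (g : Fin K → ℝ) :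
    Integrable (fun ω => g (I t ω)) P := by
  simp_rw [fun ω => apply_arm_eq_sum g (I t ω)]
  exact integrable_finsetSum _ fun i _ =>
    integrable_armIndicator_mul hI ht i (integrable_const _)

theorem IsInteraction.regret_eq [IsProbabilityMeasure P]
    (hI : IsInteraction P n f σ π I Y) (istar : ℕ → Fin K) :
    regret P n istar I Y = ∑ t ∈ Finset.range n, ∫ ω, (f t (istar t) - f t (I t ω)) ∂P := by
  unfold regret realizedRegret
  rw [integral_finsetSum]
  · refine Finset.sum_congr rfl fun t ht => ?_
    have ht := Finset.mem_range.1 ht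
    rw [integral_sub (hI.integrable_reward ht _) (hI.integrable_observed ht),
      integral_sub (integrable_const _) (hI.integrable_arm_comp ht (f t)),
      hI.mean_reward t ht, hI.integral_observed ht]
    simp
  · exact fun t ht => (hI.integrable_reward (Finset.mem_range.1 ht) _).sub
      (hI.integrable_observed (Finset.mem_range.1 ht))

theorem IsInteraction.integrable_policy [IsProbabilityMeasure P]
    (hI : IsInteraction P n f σ π I Y) {t : ℕ} (ht : t < n) (i : Fin K) :
    Integrable (fun ω => π t (history I Y t ω) i) P :=
  integrable_condExp.congr (hI.arm_law t ht i)

theorem IsInteraction.integral_mul_armIndicator [IsProbabilityMeasure P]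
    (hI : IsInteraction P n f σ π I Y) {t : ℕ} (ht : t < n) (i : Fin K) {g : History K t → ℝ}
    (hg : Measurable g) {c : ℝ} (hc : ∀ h, |g h| ≤ c) :
    ∫ ω, g (history I Y t ω) * (if I t ω = i then (1 : ℝ) else 0) ∂P =
      ∫ ω, g (history I Y t ω) * π t (history I Y t ω) i ∂P := by
  have hm : MeasurableSpace.comap (history I Y t) inferInstance ≤ ‹MeasurableSpace Ω› :=
    (hI.measurable_history ht.le).comap_le
  have hind : (I t ⁻¹' {i}).indicator (fun _ => (1 : ℝ)) =
      fun ω => if I t ω = i then (1 : ℝ) else 0 := by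
    funext ω
    by_cases h : I t ω = i <;> simp [Set.indicator, h]
  have hlaw := hI.arm_law t ht i
  rw [hind] at hlaw
  have hint : Integrable (fun ω => if I t ω = i then (1 : ℝ) else 0) P := by
    simpa using integrable_armIndicator_mul hI ht i (integrable_const (1 : ℝ))
  have hgm : StronglyMeasurable[MeasurableSpace.comap (history I Y t) inferInstance]
      (fun ω => g (history I Y t ω)) :=
    (hg.comp (comap_measurable (history I Y t))).stronglyMeasurable
  -- A bounded function of the history is pulled out of the conditional expectation; what remains is
  -- the law of the arm.
  have h1 := condExp_stronglyMeasurable_mul_of_bound hm hgm hint c (ae_of_all _ fun ω => hc _)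
  rw [← integral_condExp hm]
  refine integral_congr_ae ?_
  filter_upwards [h1, hlaw] with ω h1 h2
  have h3 : ((fun ω => g (history I Y t ω)) * fun ω => if I t ω = i then (1 : ℝ) else 0) =
      fun ω => g (history I Y t ω) * (if I t ω = i then (1 : ℝ) else 0) := rfl
  rw [h3] at h1
  rw [h1, Pi.mul_apply, h2]

/-- The rewards of round `t` can be integrated separately from the history and the pulled arm. -/
theorem IsInteraction.lintegral_eq [IsProbabilityMeasure P] (hI : IsInteraction P n f σ π I Y)
    {t : ℕ} (ht : t < n) {F : (History K t × Fin K) × (Fin K → ℝ) → ENNReal} (hF : Measurable F) :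
    ∫⁻ ω, F ((history I Y t ω, I t ω), Y t ω) ∂P =
      ∫⁻ ω, ∫⁻ ω', F ((history I Y t ω, I t ω), Y t ω') ∂P ∂P := by
  have hm1 : Measurable fun ω => (history I Y t ω, I t ω) :=
    (hI.measurable_history ht.le).prodMk (hI.measurable_arm t ht)
  have hm2 := hI.measurable_reward t ht
  have hprod := (indepFun_iff_map_prod_eq_prod_map_map hm1.aemeasurable hm2.aemeasurable).1
    (hI.indep_reward t ht)
  rw [← lintegral_map (f := F) (g := fun ω => ((history I Y t ω, I t ω), Y t ω)) hF
    (hm1.prodMk hm2), hprod, lintegral_prod _ hF.aemeasurable]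
  rw [lintegral_map (hF.lintegral_prod_right') hm1]
  refine lintegral_congr fun ω => ?_
  exact lintegral_map (hF.comp measurable_prodMk_left) hm2

end Interaction

/-! ### Concentration of the estimates -/

section Concentration

variable {Ω : Type*} [MeasurableSpace Ω] {P : Measure Ω} [IsProbabilityMeasure P] {d K n : ℕ}
  {x : ℕ → EuclideanSpace ℝ (Fin d)} {θ : Fin K → EuclideanSpace ℝ (Fin d)} {lam : ℝ} {σ : ℝ≥0}
  {π : Policy K} {I : ℕ → Ω → Fin K} {Y : ℕ → Ω → Fin K → ℝ}

/-- The exponential supermartingale of the self-normalized noise. -/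
noncomputable def expNoise (x : ℕ → EuclideanSpace ℝ (Fin d))
    (θ : Fin K → EuclideanSpace ℝ (Fin d)) (lam : ℝ) (σ : ℝ≥0) (t : ℕ) (h : History K t) : ℝ :=
  Real.exp ((noiseEnergy x θ lam t h / σ ^ 2 - infoGain K x lam t h) / 2)

theorem measurable_expNoise (t : ℕ) : Measurable fun h : History K t => expNoise x θ lam σ t h := by
  have h1 := measurable_noiseEnergy (x := x) (θ := θ) (lam := lam) t
  have h2 := measurable_infoGain (K := K) (x := x) (lam := lam) t
  unfold expNoise
  fun_prop

/-- The factor by which `expNoise` changes when arm `a` is pulled and the rewards are `y`. -/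
noncomputable def expNoiseStep (x : ℕ → EuclideanSpace ℝ (Fin d))
    (θ : Fin K → EuclideanSpace ℝ (Fin d)) (lam : ℝ) (σ : ℝ≥0) (t : ℕ) (h : History K t)
    (a : Fin K) (y : Fin K → ℝ) : ℝ :=
  Real.exp ((2 * ((σ : ℝ)⁻¹ * (y a - linMean x θ t a)) *
      ((σ : ℝ)⁻¹ * ((x t).ofLp ⬝ᵥ (gram 1 x lam t h a)⁻¹ *ᵥ noiseSum x θ t h a)) +
      ((σ : ℝ)⁻¹ * (y a - linMean x θ t a)) ^ 2 * sqWidth x lam t h a -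
      ((σ : ℝ)⁻¹ * ((x t).ofLp ⬝ᵥ (gram 1 x lam t h a)⁻¹ *ᵥ noiseSum x θ t h a)) ^ 2) /
      (2 * (1 + sqWidth x lam t h a))) / √(1 + sqWidth x lam t h a)

theorem measurable_expNoiseStep (t : ℕ) :
    Measurable fun p : (History K t × Fin K) × (Fin K → ℝ) =>
      expNoiseStep x θ lam σ t p.1.1 p.1.2 p.2 := by
  refine measurable_of_arms fun a => ?_
  have h1 := (measurable_sqWidth (x := x) (lam := lam) t a).comp
    (measurable_fst : Measurable fun p : History K t × (Fin K → ℝ) => p.1)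
  have h2 := (measurable_dotProduct_gram_inv (x := x) (lam := lam) t a measurable_id
    (measurable_const (a := (x t).ofLp)) (measurable_noiseSum (x := x) (θ := θ) t a)).comp
    (measurable_fst : Measurable fun p : History K t × (Fin K → ℝ) => p.1)
  simp only [Function.comp_def, id] at h1 h2
  unfold expNoiseStep
  dsimp only
  fun_prop

theorem expNoise_succ {Ω' : Type*} (hlam : 0 < lam) (I : ℕ → Ω' → Fin K)
    (Y : ℕ → Ω' → Fin K → ℝ) (t : ℕ) (ω : Ω') :
    expNoise x θ lam σ (t + 1) (history I Y (t + 1) ω) =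
      expNoise x θ lam σ t (history I Y t ω) *
        expNoiseStep x θ lam σ t (history I Y t ω) (I t ω) (Y t ω) := by
  have e1 : (fun s : Fin t => history I Y (t + 1) ω s.castSucc) = history I Y t ω := rfl
  have e2 : history I Y (t + 1) ω (Fin.last t) = (I t ω, Y t ω (I t ω)) := by simp [history]
  have hw := sqWidth_nonneg (x := x) hlam t (history I Y t ω) (I t ω)
  have h1 := noiseEnergy_succ (x := x) (θ := θ) hlam t (history I Y (t + 1) ω) (I t ω) _ _ _
    (by rw [e2]) rfl rfl rfl
  have h2 := infoGain_succ (x := x) hlam t (history I Y (t + 1) ω)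
  rw [e1, e2] at h1 h2
  rw [expNoise, h1, h2, expNoise, expNoiseStep]
  have h3 : √(1 + sqWidth x lam t (history I Y t ω) (I t ω)) =
      Real.exp (Real.log (1 + sqWidth x lam t (history I Y t ω) (I t ω)) / 2) := by
    rw [Real.exp_half, Real.exp_log (by linarith)]
  rw [h3, ← Real.exp_sub, ← Real.exp_add]
  congr 1
  have : 1 + sqWidth x lam t (history I Y t ω) (I t ω) ≠ 0 := by positivity
  dsimp only
  -- For `σ = 0` the noise terms vanish on both sides, since division by zero gives `0`.
  rcases eq_or_ne (σ : ℝ) 0 with hσ | hσ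
  · simp only [hσ]; ring_nf
  · field_simp
    ring

theorem lintegral_expNoiseStep_le (hσ : 0 < σ) (hlam : 0 < lam)
    (hI : IsInteraction P n (linMean x θ) σ π I Y) {t : ℕ} (ht : t < n) (h : History K t)
    (a : Fin K) : ∫⁻ ω, ENNReal.ofReal (expNoiseStep x θ lam σ t h a (Y t ω)) ∂P ≤ 1 := by
  -- Zero width forces a zero context, and the factor is 1. The mixture argument needs a Gaussian of
  -- positive variance.
  rcases (sqWidth_nonneg (x := x) hlam t h a).eq_or_lt with hw | hw
  · have hx := eq_zero_of_sqWidth_eq_zero hlam hw.symm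
    simp [expNoiseStep, ← hw, hx]
  · have hX := (hI.subgaussian_reward t ht a).const_mul (σ : ℝ)⁻¹
    have hone : (⟨(σ : ℝ)⁻¹ ^ 2, sq_nonneg _⟩ * σ ^ 2 : ℝ≥0) = 1 := by
      have : (σ : ℝ) ≠ 0 := by exact_mod_cast hσ.ne'
      exact NNReal.eq (show (σ : ℝ)⁻¹ ^ 2 * (σ : ℝ) ^ 2 = 1 by field_simp)
    rw [hone] at hX
    exact lintegral_exp_quadratic_le hX _ hw

/-- The one-step factor has mean at most 1 for each fixed history and arm. Fresh rewards are
independent of both, so the adaptive choice of the arm does no harm. -/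
theorem lintegral_expNoise_le_one (hσ : 0 < σ) (hlam : 0 < lam)
    (hI : IsInteraction P n (linMean x θ) σ π I Y) {t : ℕ} (ht : t ≤ n) :
    ∫⁻ ω, ENNReal.ofReal (expNoise x θ lam σ t (history I Y t ω)) ∂P ≤ 1 := by
  induction t with
  | zero => simp [expNoise, noiseEnergy_zero, infoGain_zero hlam]
  | succ t ih =>
    have ht' : t < n := ht
    refine le_trans ?_ (ih ht'.le)
    simp_rw [expNoise_succ hlam I Y t]
    have hF : Measurable fun p : (History K t × Fin K) × (Fin K → ℝ) =>
        ENNReal.ofReal (expNoise x θ lam σ t p.1.1 *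
          expNoiseStep x θ lam σ t p.1.1 p.1.2 p.2) := by
      have h1 := (measurable_expNoise (x := x) (θ := θ) (lam := lam) (σ := σ) t).comp
        (measurable_fst.comp measurable_fst :
          Measurable fun p : (History K t × Fin K) × (Fin K → ℝ) => p.1.1)
      have h2 := measurable_expNoiseStep (x := x) (θ := θ) (lam := lam) (σ := σ) t
      exact (h1.mul h2).ennreal_ofReal
    rw [hI.lintegral_eq ht' hF]
    refine lintegral_mono fun ω => ?_
    have hpos : 0 ≤ expNoise x θ lam σ t (history I Y t ω) := (Real.exp_pos _).le
    simp_rw [ENNReal.ofReal_mul hpos]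
    rw [lintegral_const_mul' _ _ ENNReal.ofReal_ne_top]
    exact mul_le_of_le_one_right' (lintegral_expNoiseStep_le hσ hlam hI ht' _ _)

/-- Markov's inequality at a fixed round. A bound uniform in time is unnecessary, because the rounds
are bounded separately in expectation. -/
theorem measure_expNoise_ge_le (hσ : 0 < σ) (hlam : 0 < lam)
    (hI : IsInteraction P n (linMean x θ) σ π I Y) {t : ℕ} (ht : t ≤ n) {N : ℝ} (hN : 0 < N) :
    P.real {ω | N ≤ expNoise x θ lam σ t (history I Y t ω)} ≤ 1 / N := by
  have hm : Measurable fun ω => expNoise x θ lam σ t (history I Y t ω) :=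
    (measurable_expNoise t).comp (hI.measurable_history ht)
  have h1 := meas_ge_le_lintegral_div (μ := P) hm.ennreal_ofReal.aemeasurable
    (ε := ENNReal.ofReal N) (by simpa using hN) ENNReal.ofReal_ne_top
  have h2 : {ω | ENNReal.ofReal N ≤ ENNReal.ofReal (expNoise x θ lam σ t (history I Y t ω))} =
      {ω | N ≤ expNoise x θ lam σ t (history I Y t ω)} := by
    ext ω
    exact ENNReal.ofReal_le_ofReal_iff (Real.exp_pos _).le
  rw [h2] at h1
  refine ENNReal.toReal_le_of_le_ofReal (by positivity) (h1.trans ?_)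
  rw [ENNReal.ofReal_div_of_pos hN, ENNReal.ofReal_one]
  gcongr
  exact lintegral_expNoise_le_one hσ hlam hI ht

theorem sqrt_noiseEnergy_le (hσ : 0 < σ) (hlam : 0 < lam) (hK : 2 ≤ K) (hd : 0 < d) {N L : ℝ}
    (hN : 1 ≤ N) {t : ℕ} (htn : t ≤ n) (hL : ∀ s < t, ‖x s‖ ≤ L) {h : History K t}
    (hE : expNoise x θ lam σ t h < N) :
    √(noiseEnergy x θ lam t h) ≤
      σ * √(K * d * Real.log ((1 + n * L ^ 2 / (K * d * lam)) / (1 / N))) := by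
  have hσ' : (0 : ℝ) < σ := by exact_mod_cast hσ
  have hK2 : (2 : ℝ) ≤ K := by exact_mod_cast hK
  have hd1 : (1 : ℝ) ≤ d := by exact_mod_cast hd
  have h1 : (noiseEnergy x θ lam t h / σ ^ 2 - infoGain K x lam t h) / 2 < Real.log N := by
    rwa [Real.lt_log_iff_exp_lt (by linarith)]
  have h2 := infoGain_le (x := x) (by omega) hd hlam htn hL h
  have h3 : Real.log ((1 + n * L ^ 2 / (K * d * lam)) / (1 / N)) =
      Real.log (1 + n * L ^ 2 / (K * d * lam)) + Real.log N := by
    rw [div_div_eq_mul_div, div_one, Real.log_mul (by positivity) (by linarith)]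
  -- Markov's inequality leaves `2 log N`, while `c₁` offers `K d log N`; this is where two arms are
  -- needed.
  have h4 : 2 * Real.log N ≤ K * d * Real.log N := by
    have := Real.log_nonneg hN
    gcongr
    nlinarith
  have h5 : noiseEnergy x θ lam t h / σ ^ 2 ≤
      K * d * Real.log ((1 + n * L ^ 2 / (K * d * lam)) / (1 / N)) := by
    rw [h3]; linarith
  rw [← Real.sqrt_sq hσ'.le, ← Real.sqrt_mul (by positivity)]
  refine Real.sqrt_le_sqrt ?_
  rw [div_le_iff₀ (by positivity)] at h5
  linarith

end Concentration

/-! ### The gaps and the constants of the regret bound -/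

section Constants

variable {d K n : ℕ} {x : ℕ → EuclideanSpace ℝ (Fin d)} {θ : Fin K → EuclideanSpace ℝ (Fin d)}
  {lam : ℝ}

theorem norm_le_maxLength {t : ℕ} (ht : t < n) : ‖x t‖ ≤ maxLength n x :=
  le_ciSup (f := fun s : Fin n => ‖x s‖) (Set.finite_range _).bddAbove ⟨t, ht⟩

theorem norm_sq_le_of_maxLength_sq_le (hL : maxLength n x ^ 2 ≤ lam) {t : ℕ} (ht : t < n) :
    ‖x t‖ ^ 2 ≤ lam :=
  (pow_le_pow_left₀ (norm_nonneg _) (norm_le_maxLength ht) 2).trans hL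

theorem gap_eq {t : ℕ} {istar : Fin K} (hopt : ∀ j, linMean x θ t j ≤ linMean x θ t istar)
    (i : Fin K) : gap x θ t i = linMean x θ t istar - linMean x θ t i := by
  have : Nonempty (Fin K) := ⟨istar⟩
  rw [gap, le_antisymm (ciSup_le hopt) (le_ciSup (Set.finite_range _).bddAbove istar)]

theorem gap_le_maxGap {t : ℕ} (ht : t < n) (i : Fin K) : gap x θ t i ≤ maxGap n x θ :=
  le_ciSup (f := fun p : Fin n × Fin K => gap x θ p.1 p.2) (Set.finite_range _).bddAbove
    (⟨t, ht⟩, i)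

theorem abs_linMean_le (hL : maxLength n x ^ 2 ≤ lam) {t : ℕ} (ht : t < n)
    (i : Fin K) : |linMean x θ t i| ≤ √lam * paramLength θ := by
  refine (abs_real_inner_le_norm _ _).trans ?_
  gcongr
  · exact Real.le_sqrt_of_sq_le (norm_sq_le_of_maxLength_sq_le hL ht)
  · exact Real.le_sqrt_of_sq_le (Finset.single_le_sum (f := fun j => ‖θ j‖ ^ 2)
      (fun j _ => by positivity) (Finset.mem_univ i))

theorem maxGap_nonneg (hK : 0 < K) (hn : 0 < n) : 0 ≤ maxGap n x θ := by
  have : Nonempty (Fin K) := ⟨⟨0, hK⟩⟩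
  refine le_trans ?_ (gap_le_maxGap hn ⟨0, hK⟩)
  exact sub_nonneg.2 (le_ciSup (f := linMean x θ 0) (Set.finite_range _).bddAbove _)

theorem maxGap_le (hK : 0 < K) (hn : 0 < n) (hL : maxLength n x ^ 2 ≤ lam) :
    maxGap n x θ ≤ 2 * (√lam * paramLength θ) := by
  have : Nonempty (Fin K) := ⟨⟨0, hK⟩⟩
  have : Nonempty (Fin n × Fin K) := ⟨(⟨0, hn⟩, ⟨0, hK⟩)⟩
  refine ciSup_le fun p => ?_
  obtain ⟨j, hj⟩ := exists_eq_ciSup_of_finite (f := linMean x θ p.1)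
  rw [gap, ← hj]
  have h1 := abs_le.1 (abs_linMean_le (θ := θ) hL p.1.2 j)
  have h2 := abs_le.1 (abs_linMean_le (θ := θ) hL p.1.2 p.2)
  linarith

theorem paramLength_nonneg : 0 ≤ paramLength θ := Real.sqrt_nonneg _

theorem one_half_le_log_add_one (hn : 0 < n) : 1 / 2 ≤ Real.log (n + 1) := by
  have h1 : (2 : ℝ) ≤ n + 1 := by
    have : (1 : ℝ) ≤ n := by exact_mod_cast hn
    linarith
  have h2 := Real.log_le_log two_pos h1
  have h3 := Real.log_two_gt_d9
  linarith

theorem div_le_of_sq_le {L : ℝ} (hK : 0 < K) (hd : 0 < d) (hlam : 0 < lam) (hL : L ^ 2 ≤ lam) :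
    1 + n * L ^ 2 / (K * d * lam) ≤ n + 1 := by
  have hK1 : (1 : ℝ) ≤ K := by exact_mod_cast hK
  have hd1 : (1 : ℝ) ≤ d := by exact_mod_cast hd
  rw [add_comm]
  gcongr
  rw [div_le_iff₀ (by positivity)]
  have : 1 * lam ≤ K * d * lam := by
    gcongr
    nlinarith
  have : (n : ℝ) * L ^ 2 ≤ n * (K * d * lam) := by
    gcongr
    linarith
  exact this

theorem c₁_nonneg {σ : ℝ} (hσ : 0 ≤ σ) {L Lstar δ : ℝ} (hs : 0 ≤ Lstar) :
    0 ≤ c₁ K d n σ lam L Lstar δ := by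
  unfold c₁
  positivity

theorem c₁_le {σ : ℝ} (hσ : 0 ≤ σ) {L Lstar : ℝ} (hs : 0 ≤ Lstar) (hK : 0 < K) (hd : 0 < d)
    (hn : 0 < n) (hlam : 0 < lam) (hL : L ^ 2 ≤ lam) :
    c₁ K d n σ lam L Lstar (1 / n) ≤
      2 * (σ + √lam * Lstar) * √(K * d) * √(Real.log (n + 1)) := by
  have hn' : (0 : ℝ) < n := by exact_mod_cast hn
  have hK1 : (1 : ℝ) ≤ K := by exact_mod_cast hK
  have hd1 : (1 : ℝ) ≤ d := by exact_mod_cast hd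
  have hl := one_half_le_log_add_one hn
  have h1 : Real.log ((1 + n * L ^ 2 / (K * d * lam)) / (1 / n)) ≤ 4 * Real.log (n + 1) := by
    rw [div_div_eq_mul_div, div_one, Real.log_mul (by positivity) hn'.ne']
    have h2 := Real.log_le_log (by positivity) (div_le_of_sq_le (n := n) hK hd hlam hL)
    have h3 : Real.log n ≤ Real.log (n + 1) := Real.log_le_log hn' (by linarith)
    linarith
  have h2 : √(K * d * Real.log ((1 + n * L ^ 2 / (K * d * lam)) / (1 / n))) ≤
      2 * (√(K * d) * √(Real.log (n + 1))) := by
    rw [← Real.sqrt_mul (by positivity)]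
    refine Real.sqrt_le_iff.2 ⟨by positivity, ?_⟩
    rw [mul_pow, Real.sq_sqrt (by positivity)]
    calc _ ≤ K * d * (4 * Real.log (n + 1)) := by gcongr
      _ = _ := by ring
  -- Lets the bias `√λ L_*` be absorbed into the product form; `√(log (n + 1)) ≥ 1/2` makes the
  -- factor 2 enough.
  have h3 : 1 ≤ 2 * (√(K * d) * √(Real.log (n + 1))) := by
    have ha : 1 ≤ √((K : ℝ) * d) := Real.one_le_sqrt.2 (by nlinarith)
    have hb : 1 / 2 ≤ √(Real.log (n + 1)) := Real.le_sqrt_of_sq_le (by linarith)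
    nlinarith
  unfold c₁
  calc _ ≤ σ * (2 * (√(K * d) * √(Real.log (n + 1)))) +
        √lam * Lstar * (2 * (√(K * d) * √(Real.log (n + 1)))) := by
        exact add_le_add (mul_le_mul_of_nonneg_left h2 hσ)
          (le_mul_of_one_le_right (mul_nonneg (Real.sqrt_nonneg lam) hs) h3)
    _ = _ := by ring

theorem c₂_le {L : ℝ} (hK : 0 < K) (hd : 0 < d) (hlam : 0 < lam) (hL : L ^ 2 ≤ lam) :
    c₂ K d n lam L ≤ 2 * (K * d) * Real.log (n + 1) := by
  unfold c₂
  have h2 := Real.log_le_log (by positivity) (div_le_of_sq_le (n := n) hK hd hlam hL)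
  calc _ ≤ 2 * K * d * Real.log (n + 1) := by gcongr
    _ = _ := by ring

theorem rpow_three_halves {a : ℝ} (ha : 0 < a) : a ^ (3 / 2 : ℝ) = a * √a := by
  rw [Real.sqrt_eq_rpow, show (3 / 2 : ℝ) = 1 + 1 / 2 by norm_num, Real.rpow_add ha,
    Real.rpow_one]

/-- The main term costs `39 · 2 · 2 = 156`, since `12 K e + 3 ≤ 39 K`. The `Δ_max` term costs 16, as
`(K + 1) M ≤ 4 B K` and `1 ≤ 4 l √l` for `l = log (n + 1)`. -/
theorem regret_bound_le {B A₁ A₂ M : ℝ} (hK : 0 < K) (hd : 0 < d) (hn : 0 < n) (hB : 0 ≤ B)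
    (hA₁ : A₁ ≤ 2 * B * √(K * d) * √(Real.log (n + 1)))
    (hA₂ : A₂ ≤ 2 * (K * d) * Real.log (n + 1)) (hM : M ≤ 2 * B) :
    (12 * K * Real.exp 1 + 3) * A₁ * √(A₂ * n * Real.log n) + (K + 1) * M ≤
      200 * B * (K ^ 2 * d * √n) * Real.log (n + 1) ^ (3 / 2 : ℝ) := by
  have hn1 : (1 : ℝ) ≤ n := by exact_mod_cast hn
  have hK1 : (1 : ℝ) ≤ K := by exact_mod_cast hK
  have hd1 : (1 : ℝ) ≤ d := by exact_mod_cast hd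
  have hl := one_half_le_log_add_one hn
  rw [rpow_three_halves (by linarith)]
  have hlog : Real.log n ≤ Real.log (n + 1) := Real.log_le_log (by linarith) (by linarith)
  have hlog0 : 0 ≤ Real.log n := Real.log_nonneg hn1
  set l := Real.log (n + 1)
  have hsl : 1 / 2 ≤ √l := Real.le_sqrt_of_sq_le (by linarith)
  have hsn : 1 ≤ √(n : ℝ) := Real.one_le_sqrt.2 hn1
  have h1 : √(A₂ * n * Real.log n) ≤ 2 * √(K * d) * √n * l := by
    refine Real.sqrt_le_iff.2 ⟨by positivity, ?_⟩
    calc A₂ * n * Real.log n ≤ 2 * (K * d) * l * n * l := by gcongr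
      _ ≤ 4 * (K * d) * l * n * l := by gcongr; norm_num
      _ = 2 ^ 2 * √(K * d) ^ 2 * √n ^ 2 * l ^ 2 := by
          rw [Real.sq_sqrt (by positivity), Real.sq_sqrt (by positivity)]; ring
      _ = _ := by ring
  have he : 12 * K * Real.exp 1 + 3 ≤ 39 * K := by
    have := Real.exp_one_lt_d9
    nlinarith
  have h2 : (12 * K * Real.exp 1 + 3) * A₁ * √(A₂ * n * Real.log n) ≤
      156 * B * (K ^ 2 * d * √n) * (l * √l) := by
    calc _ ≤ (12 * K * Real.exp 1 + 3) * (2 * B * √(K * d) * √l) * (2 * √(K * d) * √n * l) := by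
          gcongr
      _ ≤ (39 * K) * (2 * B * √(K * d) * √l) * (2 * √(K * d) * √n * l) := by gcongr
      _ = 156 * K * B * √(K * d) ^ 2 * √n * (l * √l) := by ring
      _ = _ := by rw [Real.sq_sqrt (by positivity)]; ring
  have h3 : (K + 1) * M ≤ 16 * B * (K ^ 2 * d * √n) * (l * √l) := by
    have ha : 1 ≤ 4 * (l * √l) := by nlinarith
    have hb : 1 ≤ d * √(n : ℝ) := by nlinarith
    have hc : (K : ℝ) ≤ K ^ 2 := by nlinarith
    calc (K + 1) * M ≤ (K + 1) * (2 * B) := by gcongr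
      _ ≤ (K + K) * (2 * B) := by gcongr
      _ = 4 * B * (K * 1) * 1 := by ring
      _ ≤ 4 * B * (K ^ 2 * (d * √n)) * (4 * (l * √l)) := by gcongr
      _ = _ := by ring
  have h4 : 0 ≤ B * (K ^ 2 * d * √n) * (l * √l) := by positivity
  linarith

end Constants

/-! ### The regret of CoSoftElim -/

section Regret

variable {Ω : Type*} [MeasurableSpace Ω] {P : Measure Ω} [IsProbabilityMeasure P] {d K n : ℕ}
  {x : ℕ → EuclideanSpace ℝ (Fin d)} {θ : Fin K → EuclideanSpace ℝ (Fin d)} {lam : ℝ} {σ : ℝ≥0}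
  {π : Policy K} {I : ℕ → Ω → Fin K} {Y : ℕ → Ω → Fin K → ℝ}

theorem sqrt_sqWidth_le_one (hlam : 0 < lam) {t : ℕ} (hx : ‖x t‖ ^ 2 ≤ lam) (h : History K t)
    (i : Fin K) : √(sqWidth x lam t h i) ≤ 1 := by
  rw [Real.sqrt_le_one]
  have := (mul_sqWidth_le (x := x) hlam t h i).trans hx
  nlinarith

theorem sum_coSoftElim_mul_gap_le {A M N : ℝ} {t : ℕ} {istar : Fin K} {h : History K t}
    (hlam : 0 < lam) (hA : 0 < A) (hN : 1 ≤ N)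
    (hnoise : √(noiseEnergy x θ lam t h) + √lam * paramLength θ ≤ A)
    (hopt : ∀ j, linMean x θ t j ≤ linMean x θ t istar)
    (hM : ∀ i, linMean x θ t istar - linMean x θ t i ≤ M) :
    ∑ i, coSoftElim 1 x lam ((A ^ 2)⁻¹) t h i * (linMean x θ t istar - linMean x θ t i) ≤
      K * M / N + (√(Real.log N) + 1 + K * Real.exp 1) * A *
        ∑ i, coSoftElim 1 x lam ((A ^ 2)⁻¹) t h i * √(sqWidth x lam t h i) := by
  refine sum_softmax_mul_gap_le (est := estMean 1 x lam t h) hA hN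
    (fun i => Real.sqrt_nonneg _) (fun i hi => ?_) (fun i => ?_) hopt hM _
    (score 1 x lam ((A ^ 2)⁻¹) t h) (fun i => ?_) fun i => rfl
  -- A zero width means `x_t = 0`, so all estimates equal `0`.
  · rw [Real.sqrt_eq_zero (sqWidth_nonneg hlam t h i)] at hi
    have hx := eq_zero_of_sqWidth_eq_zero hlam hi
    simp [estMean, hx]
  · refine (abs_estMean_sub_linMean_le hlam t h i).trans ?_
    gcongr
  · rw [score, wnorm_gram_inv]

theorem coSoftElim_nonneg (γ : ℝ) (t : ℕ) (h : History K t) (i : Fin K) :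
    0 ≤ coSoftElim 1 x lam γ t h i :=
  div_nonneg (Real.exp_pos _).le (Finset.sum_nonneg fun _ _ => (Real.exp_pos _).le)

theorem integrable_sqrt_sqWidth (hlam : 0 < lam) {f : ℕ → Fin K → ℝ}
    (hI : IsInteraction P n f σ π I Y) {t : ℕ} (ht : t < n) (hx : ‖x t‖ ^ 2 ≤ lam) :
    Integrable (fun ω => √(sqWidth x lam t (history I Y t ω) (I t ω))) P := by
  have hm : Measurable fun p : History K t × Fin K => √(sqWidth x lam t p.1 p.2) :=
    measurable_from_prod_countable_left fun i => (measurable_sqWidth t i).sqrt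
  refine Integrable.of_bound (C := 1) (hm.comp ((hI.measurable_history ht.le).prodMk
    (hI.measurable_arm t ht))).aestronglyMeasurable (ae_of_all _ fun ω => ?_)
  rw [Real.norm_of_nonneg (Real.sqrt_nonneg _)]
  exact sqrt_sqWidth_le_one hlam hx _ _

/-- Functions of the history can be averaged over the pulled arm or over the policy. -/
theorem integral_arm_eq_integral_policy {f : ℕ → Fin K → ℝ}
    (hI : IsInteraction P n f σ π I Y) {t : ℕ} (ht : t < n) {g : History K t → Fin K → ℝ}
    (hg : ∀ i, Measurable fun h => g h i) {c : ℝ} (hc : ∀ h i, |g h i| ≤ c) :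
    ∫ ω, g (history I Y t ω) (I t ω) ∂P =
      ∫ ω, ∑ i, g (history I Y t ω) i * π t (history I Y t ω) i ∂P := by
  have hH := hI.measurable_history ht.le
  have hgb : ∀ i, ∀ᵐ ω ∂P, ‖g (history I Y t ω) i‖ ≤ c := fun i => ae_of_all _ fun ω => hc _ i
  have hgm : ∀ i, AEStronglyMeasurable (fun ω => g (history I Y t ω) i) P := fun i =>
    ((hg i).comp hH).aestronglyMeasurable
  have hone : ∀ i, Integrable (fun ω => if I t ω = i then (1 : ℝ) else 0) P := fun i => by
    simpa using integrable_armIndicator_mul hI ht i (integrable_const (1 : ℝ))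
  rw [integral_finsetSum _ fun i _ => (hI.integrable_policy ht i).bdd_mul (hgm i) (hgb i)]
  simp_rw [← fun i => hI.integral_mul_armIndicator ht i (hg i) (fun h => hc h i)]
  rw [← integral_finsetSum _ fun i _ => (hone i).bdd_mul (hgm i) (hgb i)]
  simp

/-- The arm is averaged out to the policy, the softmax bound is applied to each good history, and
the resulting mean width is turned back into the width of the pulled arm. -/
theorem integral_gap_le {A M : ℝ} (hσ : 0 < σ) (hlam : 0 < lam) (hK : 2 ≤ K) (hd : 0 < d)
    (hn : 0 < n) (hA : 0 < A) (hL : maxLength n x ^ 2 ≤ lam)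
    (hAle : c₁ K d n σ lam (maxLength n x) (paramLength θ) (1 / n) ≤ A)
    (hI : IsInteraction P n (linMean x θ) σ (coSoftElim 1 x lam ((A ^ 2)⁻¹)) I Y)
    {t : ℕ} (ht : t < n) {istar : Fin K}
    (hopt : ∀ j, linMean x θ t j ≤ linMean x θ t istar)
    (hM : ∀ i, linMean x θ t istar - linMean x θ t i ≤ M) :
    ∫ ω, (linMean x θ t istar - linMean x θ t (I t ω)) ∂P ≤
      M / n + (K * M / n + (√(Real.log n) + 1 + K * Real.exp 1) * A *
        ∫ ω, √(sqWidth x lam t (history I Y t ω) (I t ω)) ∂P) := by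
  have hn1 : (1 : ℝ) ≤ n := by exact_mod_cast hn
  have hx := norm_sq_le_of_maxLength_sq_le hL ht
  have hM0 : 0 ≤ M := (sub_nonneg.2 (hopt istar)).trans (hM istar)
  have hH := hI.measurable_history ht.le
  set π := coSoftElim (K := K) 1 x lam ((A ^ 2)⁻¹) with hπ
  set Δ : Fin K → ℝ := fun i => linMean x θ t istar - linMean x θ t i with hΔ
  -- The bad histories, on which the confidence intervals may fail.
  set s : Set (History K t) := {h | (n : ℝ) ≤ expNoise x θ lam σ t h} with hs
  have hsm : MeasurableSet s := measurableSet_le measurable_const (measurable_expNoise t)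
  -- The gap cut off on bad histories, where `M` pays instead. It stays a bounded function of
  -- history and arm, so the policy can replace the pulled arm.
  set g : History K t → Fin K → ℝ := fun h i => sᶜ.indicator (fun _ => Δ i) h with hg
  have hgm : ∀ i, Measurable fun h => g h i := fun i => measurable_const.indicator hsm.compl
  have hΔabs : ∀ i, |Δ i| ≤ M := fun i => by
    rw [abs_of_nonneg (sub_nonneg.2 (hopt i))]; exact hM i
  have hgM : ∀ h i, |g h i| ≤ M := fun h i => by
    simp only [hg, Set.indicator_apply]
    split_ifs
    · exact hΔabs i
    · simpa using hM0
  have hwm : ∀ i, Measurable fun h : History K t => √(sqWidth x lam t h i) := fun i =>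
    (measurable_sqWidth t i).sqrt
  have hw1 : ∀ (h : History K t) i, |√(sqWidth x lam t h i)| ≤ 1 := fun h i => by
    rw [abs_of_nonneg (Real.sqrt_nonneg _)]; exact sqrt_sqWidth_le_one hlam hx h i
  have hpolw : Integrable (fun ω => ∑ i, √(sqWidth x lam t (history I Y t ω) i) *
      π t (history I Y t ω) i) P :=
    integrable_finsetSum _ fun i _ => (hI.integrable_policy ht i).bdd_mul
      ((hwm i).comp hH).aestronglyMeasurable (ae_of_all _ fun ω => hw1 _ i)
  have hpolg : Integrable (fun ω => ∑ i, g (history I Y t ω) i * π t (history I Y t ω) i) P :=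
    integrable_finsetSum _ fun i _ => (hI.integrable_policy ht i).bdd_mul
      ((hgm i).comp hH).aestronglyMeasurable (ae_of_all _ fun ω => hgM _ i)
  have hgi : Integrable (fun ω => g (history I Y t ω) (I t ω)) P := by
    have : Measurable fun p : History K t × Fin K => g p.1 p.2 :=
      measurable_from_prod_countable_left hgm
    exact Integrable.of_bound (this.comp (hH.prodMk (hI.measurable_arm t ht))).aestronglyMeasurable
      M (ae_of_all _ fun ω => hgM _ _)
  have hsP : MeasurableSet (history I Y t ⁻¹' s) := hH hsm
  have hbad : Integrable ((history I Y t ⁻¹' s).indicator fun _ => M) P :=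
    (integrable_const M).indicator hsP
  calc ∫ ω, Δ (I t ω) ∂P
      ≤ ∫ ω, ((history I Y t ⁻¹' s).indicator (fun _ => M) ω +
          g (history I Y t ω) (I t ω)) ∂P := by
        refine integral_mono (hI.integrable_arm_comp ht Δ) (hbad.add hgi) fun ω => ?_
        by_cases hω : history I Y t ω ∈ s
        · simpa only [hg, Set.mem_preimage, hω, Set.indicator_of_mem, Set.mem_compl_iff,
            not_true_eq_false, not_false_eq_true, Set.indicator_of_notMem, add_zero] using hM (I t ω)
        · simp [hg, hω]
    _ = M * P.real (history I Y t ⁻¹' s) +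
          ∫ ω, ∑ i, g (history I Y t ω) i * π t (history I Y t ω) i ∂P := by
        rw [integral_add hbad hgi, integral_indicator_const _ hsP,
          integral_arm_eq_integral_policy hI ht hgm hgM, smul_eq_mul, mul_comm]
    _ ≤ M / n + ∫ ω, (K * M / n + (√(Real.log n) + 1 + K * Real.exp 1) * A *
          ∑ i, √(sqWidth x lam t (history I Y t ω) i) * π t (history I Y t ω) i) ∂P := by
        refine add_le_add ?_ (integral_mono hpolg
          ((integrable_const _).add (hpolw.const_mul _)) fun ω => ?_)
        · rw [div_eq_mul_one_div]
          exact mul_le_mul_of_nonneg_left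
            (measure_expNoise_ge_le hσ hlam hI ht.le (by linarith)) hM0
        · dsimp only
          by_cases hω : history I Y t ω ∈ s
          · have h0 : ∀ i, g (history I Y t ω) i = 0 := fun i => by simp [hg, hω]
            simp only [h0, zero_mul, Finset.sum_const_zero]
            have h1 : 0 ≤ ∑ i, √(sqWidth x lam t (history I Y t ω) i) *
                π t (history I Y t ω) i :=
              Finset.sum_nonneg fun i _ => mul_nonneg (Real.sqrt_nonneg _)
                (coSoftElim_nonneg _ _ _ _)
            positivity
          · have h0 : ∀ i, g (history I Y t ω) i = Δ i := fun i => by simp [hg, hω]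
            simp only [h0, mul_comm _ (π t (history I Y t ω) _)]
            refine sum_coSoftElim_mul_gap_le hlam hA hn1 (le_trans ?_ hAle) hopt hM
            unfold c₁
            gcongr
            exact sqrt_noiseEnergy_le hσ hlam hK hd hn1 ht.le
              (fun s hs => norm_le_maxLength (hs.trans ht)) (not_le.1 hω)
    _ = _ := by
        rw [integral_add (integrable_const _) (hpolw.const_mul _), integral_const_mul,
          integral_arm_eq_integral_policy hI ht hwm hw1]
        simp

/-- Cauchy–Schwarz over the rounds and the elliptical potential bound hold on every sample path;
only then is the expectation taken. -/
theorem sum_integral_sqrt_sqWidth_le (hK : 0 < K) (hd : 0 < d) (hlam : 0 < lam)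
    (hL : maxLength n x ^ 2 ≤ lam) {f : ℕ → Fin K → ℝ} (hI : IsInteraction P n f σ π I Y) :
    ∑ t ∈ Finset.range n, ∫ ω, √(sqWidth x lam t (history I Y t ω) (I t ω)) ∂P ≤
      √(c₂ K d n lam (maxLength n x) * n) := by
  have hint : ∀ t ∈ Finset.range n,
      Integrable (fun ω => √(sqWidth x lam t (history I Y t ω) (I t ω))) P := fun t ht =>
    integrable_sqrt_sqWidth hlam hI (Finset.mem_range.1 ht)
      (norm_sq_le_of_maxLength_sq_le hL (Finset.mem_range.1 ht))
  rw [← integral_finsetSum _ hint]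
  have hpath : ∀ ω, ∑ t ∈ Finset.range n, √(sqWidth x lam t (history I Y t ω) (I t ω)) ≤
      √(c₂ K d n lam (maxLength n x) * n) := by
    intro ω
    refine Real.le_sqrt_of_sq_le ?_
    refine (sq_sum_le_card_mul_sum_sq).trans ?_
    rw [Finset.card_range, mul_comm]
    gcongr
    calc ∑ t ∈ Finset.range n, √(sqWidth x lam t (history I Y t ω) (I t ω)) ^ 2
        = ∑ t ∈ Finset.range n, sqWidth x lam t (history I Y t ω) (I t ω) :=
          Finset.sum_congr rfl fun t _ => Real.sq_sqrt (sqWidth_nonneg hlam _ _ _)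
      _ ≤ 2 * infoGain K x lam n (history I Y n ω) :=
          sum_sqWidth_le hlam I Y ω n fun t ht => norm_sq_le_of_maxLength_sq_le hL ht
      _ ≤ 2 * (K * d * Real.log (1 + n * maxLength n x ^ 2 / (K * d * lam))) := by
          gcongr
          exact infoGain_le hK hd hlam le_rfl (fun s hs => norm_le_maxLength hs) _
      _ = _ := by unfold c₂; ring
  calc _ ≤ ∫ _ω, √(c₂ K d n lam (maxLength n x) * n) ∂P :=
        integral_mono (integrable_finsetSum _ hint) (integrable_const _) hpath
    _ = _ := by simp

theorem regret_le_of_forall_gap_le {D : ℝ} {istar : ℕ → Fin K}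
    (hI : IsInteraction P n (linMean x θ) σ π I Y)
    (hD : ∀ t < n, ∀ i, linMean x θ t (istar t) - linMean x θ t i ≤ D) :
    regret P n istar I Y ≤ n * D := by
  rw [hI.regret_eq]
  calc _ ≤ ∑ t ∈ Finset.range n, D := by
        refine Finset.sum_le_sum fun t ht => ?_
        have ht := Finset.mem_range.1 ht
        calc _ ≤ ∫ _ω, D ∂P := integral_mono
              ((integrable_const _).sub (hI.integrable_arm_comp ht (linMean x θ t)))
              (integrable_const _) fun ω => hD t ht _
          _ = D := by simp
    _ = n * D := by simp

theorem regret_coSoftElim_le (hσ : 0 < σ) (hlam : 0 < lam) (hK : 0 < K) (hd : 0 < d)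
    (hn : 0 < n) (hL : maxLength n x ^ 2 ≤ lam) {A₁ A₂ : ℝ}
    (hA₁ : A₁ = c₁ K d n σ lam (maxLength n x) (paramLength θ) (1 / n))
    (hA₂ : A₂ = c₂ K d n lam (maxLength n x)) {istar : ℕ → Fin K}
    (hopt : ∀ t < n, ∀ j, linMean x θ t j ≤ linMean x θ t (istar t))
    (hI : IsInteraction P n (linMean x θ) σ (coSoftElim 1 x lam ((A₁ ^ 2)⁻¹)) I Y) :
    regret P n istar I Y ≤ (12 * K * Real.exp 1 + 3) * A₁ * √(A₂ * n * Real.log n) +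
      (K + 1) * maxGap n x θ := by
  have hM0 := maxGap_nonneg (x := x) (θ := θ) hK hn
  have hA0 : 0 ≤ A₁ := hA₁ ▸ c₁_nonneg σ.2 paramLength_nonneg
  have hfirst : 0 ≤ (12 * K * Real.exp 1 + 3) * A₁ * √(A₂ * n * Real.log n) := by positivity
  have hM : ∀ t < n, ∀ i, linMean x θ t (istar t) - linMean x θ t i ≤ maxGap n x θ :=
    fun t ht i => by
      rw [← gap_eq (hopt t ht)]
      exact gap_le_maxGap ht i
  have hKM : 0 ≤ K * maxGap n x θ := by positivity
  -- With one arm there is no regret, and with one round it is at most `Δ_max`. The possibility `A₁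
  -- = 0`, where the inverse makes the score parameter `0`, can occur only in these cases.
  rcases (show K = 1 ∨ 2 ≤ K by omega) with rfl | hK2
  · have h0 := regret_le_of_forall_gap_le (D := 0) (istar := istar) hI fun t ht i => by
      rw [Subsingleton.elim i (istar t), sub_self]
    linarith
  rcases (show n = 1 ∨ 2 ≤ n by omega) with rfl | hn2
  · have h0 := regret_le_of_forall_gap_le hI hM
    rw [Nat.cast_one, one_mul] at h0
    linarith
  have hn2' : (2 : ℝ) ≤ n := by exact_mod_cast hn2
  have hK2' : (2 : ℝ) ≤ K := by exact_mod_cast hK2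
  have hlog : 1 / 2 ≤ Real.log n := by
    have h1 := Real.log_le_log two_pos hn2'
    have h2 := Real.log_two_gt_d9
    linarith
  have hApos : 0 < A₁ := by
    have h1 : 0 < Real.log ((1 + n * maxLength n x ^ 2 / (K * d * lam)) / (1 / n)) := by
      refine Real.log_pos ?_
      rw [div_div_eq_mul_div, div_one]
      have : 0 ≤ n * maxLength n x ^ 2 / (K * d * lam) := by positivity
      nlinarith
    have h2 := mul_nonneg (Real.sqrt_nonneg lam) (paramLength_nonneg (θ := θ))
    rw [hA₁, c₁]
    have h3 : (0 : ℝ) < σ := by exact_mod_cast hσ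
    positivity
  have hw := sum_integral_sqrt_sqWidth_le (x := x) hK hd hlam hL hI
  rw [← hA₂] at hw
  have hsl : 1 / 2 ≤ √(Real.log n) := Real.le_sqrt_of_sq_le (by linarith)
  -- From `n ≥ 2`, `√(log n) ≥ 1/2`, so the constants `1` and `K e` are at most `2 √(log n)` and `2
  -- K e √(log n)`.
  have hc : √(Real.log n) + 1 + K * Real.exp 1 ≤
      (12 * K * Real.exp 1 + 3) * √(Real.log n) := by
    have h1 : 0 ≤ K * Real.exp 1 := by positivity
    nlinarith
  rw [hI.regret_eq]
  calc _ ≤ ∑ t ∈ Finset.range n, (maxGap n x θ / n + (K * maxGap n x θ / n +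
          (√(Real.log n) + 1 + K * Real.exp 1) * A₁ *
            ∫ ω, √(sqWidth x lam t (history I Y t ω) (I t ω)) ∂P)) :=
        Finset.sum_le_sum fun t ht => integral_gap_le hσ hlam hK2 hd hn hApos hL hA₁.ge hI
          (Finset.mem_range.1 ht) (hopt t (Finset.mem_range.1 ht)) (hM t (Finset.mem_range.1 ht))
    _ = (√(Real.log n) + 1 + K * Real.exp 1) * A₁ * (∑ t ∈ Finset.range n,
          ∫ ω, √(sqWidth x lam t (history I Y t ω) (I t ω)) ∂P) + (K + 1) * maxGap n x θ := by
        simp only [Finset.sum_add_distrib, ← Finset.mul_sum, Finset.sum_const, Finset.card_range,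
          nsmul_eq_mul]
        field_simp
        ring
    _ ≤ (12 * K * Real.exp 1 + 3) * √(Real.log n) * A₁ * √(A₂ * n) +
          (K + 1) * maxGap n x θ := by gcongr
    _ = _ := by
        rw [Real.sqrt_mul' _ (by linarith : 0 ≤ Real.log n)]
        ring

end Regret

end Bandit
theorem theorem4 :
    ∃ C : ℝ, 0 < C ∧
      ∀ (K d n : ℕ), 0 < K → 0 < d → 0 < n →
      ∀ (x : ℕ → EuclideanSpace ℝ (Fin d)) (θ : Fin K → EuclideanSpace ℝ (Fin d))
        (σ : ℝ≥0) (lam A₁ A₂ : ℝ), 0 < σ → 0 < lam →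
      Bandit.maxLength n x ^ 2 ≤ lam →
      A₁ = Bandit.c₁ K d n σ lam (Bandit.maxLength n x) (Bandit.paramLength θ) (1 / n) →
      A₂ = Bandit.c₂ K d n lam (Bandit.maxLength n x) →
      A₁ ≤ C * (σ + √lam * Bandit.paramLength θ) * √(K * d) * √(Real.log (n + 1)) ∧
      A₂ ≤ C * (K * d) * Real.log (n + 1) ∧
      ∀ {Ω : Type*} [MeasurableSpace Ω] (P : Measure Ω) [IsProbabilityMeasure P]
        (I : ℕ → Ω → Fin K) (Y : ℕ → Ω → Fin K → ℝ) (istar : ℕ → Fin K),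
      (∀ t < n, ∀ j, Bandit.linMean x θ t j ≤ Bandit.linMean x θ t (istar t)) →
      Bandit.IsInteraction P n (Bandit.linMean x θ) σ
        (Bandit.coSoftElim 1 x lam ((A₁ ^ 2)⁻¹)) I Y →
      Integrable (Bandit.realizedRegret n istar I Y) P ∧
      Bandit.regret P n istar I Y
        ≤ (12 * K * Real.exp 1 + 3) * A₁ * √(A₂ * n * Real.log n)
          + (K + 1) * Bandit.maxGap n x θ ∧
      Bandit.regret P n istar I Y
        ≤ C * (σ + √lam * Bandit.paramLength θ) * (K ^ 2 * d * √n)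
          * Real.log (n + 1) ^ (3 / 2 : ℝ) := by
  -- Any constant at least `156 + 16` works for the regret; `c₁` and `c₂` need only 2.
  refine ⟨200, by norm_num, ?_⟩
  intro K d n hK hd hn x θ σ lam A₁ A₂ hσ hlam hL hA₁ hA₂
  have hB : 0 ≤ (σ : ℝ) + √lam * Bandit.paramLength θ :=
    add_nonneg σ.2 (mul_nonneg (Real.sqrt_nonneg _) Bandit.paramLength_nonneg)
  have h1 : A₁ ≤ 2 * (σ + √lam * Bandit.paramLength θ) * √(K * d) * √(Real.log (n + 1)) := by
    rw [hA₁]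
    exact Bandit.c₁_le σ.2 Bandit.paramLength_nonneg hK hd hn hlam hL
  have h2 : A₂ ≤ 2 * (K * d) * Real.log (n + 1) := by
    rw [hA₂]
    exact Bandit.c₂_le hK hd hlam hL
  have hl : 0 ≤ Real.log (n + 1) := by
    have := Bandit.one_half_le_log_add_one hn
    linarith
  refine ⟨h1.trans ?_, h2.trans ?_, ?_⟩
  · gcongr
    norm_num
  · gcongr
    norm_num
  intro Ω _ P _ I Y istar hopt hI
  have hreg := Bandit.regret_coSoftElim_le hσ hlam hK hd hn hL hA₁ hA₂ hopt hI
  refine ⟨hI.integrable_realizedRegret istar, hreg, hreg.trans ?_⟩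
  refine Bandit.regret_bound_le hK hd hn hB h1 h2 ?_
  have hM := Bandit.maxGap_le (θ := θ) hK hn hL
  have := σ.2
  linarith
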